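/- Let $p$ and $\ell$ be distinct odd primes and $k\ge 1$ an integer such that $p$ is a primitive root modulo $2\ell^k$. Put $e=\phi(\ell^k)=(\ell-1)\ell^{k-1}$ ($\phi$ is Euler's function), $q=p^e$ and $N=\frac{q-1}{2\ell^k}$, and let $\operatorname{Tr}$ be the trace map from $\mathbb{F}_q$ to $\mathbb{F}_p$. For $u\in\mathbb{F}_p$ let $$D_u=\{(x,y)\in\mathbb{F}_q^2\setminus\{(0,0)\}:\operatorname{Tr}(x+y^N)=u\},\qquad \mathcal{C}_{D_u}=\{(\operatorname{Tr}(\gamma x+\delta y))_{(x,y)\in D_u}:\gamma,\delta\in\mathbb{F}_q\}.$$ Then $\mathcal{C}_{D_u}$ is a linear code over $\mathbb{F}_p$ of length $p^{2e-1}-1$ if $u=0$ and $p^{2e-1}$ if $u\ne 0$, and of dimension $2e$. Its weight distribution is given below as a list of entries "weight : frequency". The zero codeword (weight $0$, frequency $1$) is always part of the list and is not repeated; frequencies of entries with equal weight are to be added, and an entry of frequency $0$ is void. A code is called $t$-weight if exactly $t$ nonzero Hamming weights occur among its codewords. 1. If $u=0$ and $\ell\equiv 1\pmod p$: - $p^{e-1}(\ell-1)\frac{q-1}{\ell^k}$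 : $p-1$ - $p^{2e-2}(p-1)+p^{e-1}\left(\sqrt q-(\ell-1)\frac{\sqrt q+1}{\ell^k}\right)$ : $(p-1)(\ell-1)\frac{q-1}{\ell^k}$ - $p^{2e-2}(p-1)-p^{e-1}(\ell-1)\frac{\sqrt q+1}{\ell^k}$ : $(p-1)(\ell^k-\ell+1)\frac{q-1}{\ell^k}$ - $p^{2e-2}(p-1)$ : $(q-1)+(q-p)q$ and the code is four-weight. 2. If $u=0$ and $\ell\not\equiv 1\pmod p$: - $p^{e-1}\frac{q-1}{\ell^{k-1}}$ : $p-1$ - $p^{2e-2}(p-1)+p^{e-1}\left(\sqrt q-\frac{\sqrt q+1}{\ell^{k-1}}\right)$ : $(p-1)\frac{q-1}{\ell^{k-1}}$ - $p^{2e-2}(p-1)-p^{e-1}\frac{\sqrt q+1}{\ell^{k-1}}$ : $(p-1)(\ell^{k-1}-1)\frac{q-1}{\ell^{k-1}}$ - $p^{2e-2}(p-1)$ : $(q-1)+(q-p)q$ and the code is four-weight if $k\ge 2$ and three-weight if $k=1$. 3. If $u\ne 0$, $u^2\not\equiv\phi(\ell^k)^2\pmod p$ and $u^2\not\equiv\ell^{2(k-1)}\pmod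 p$: - $p^{2e-1}$ : $p-1$ - $p^{2e-2}(p-1)$ : $q^2-p$ and the code is two-weight. 4. If $u\ne 0$, $u^2\equiv\phi(\ell^k)^2\pmod p$ and $u^2\not\equiv\ell^{2(k-1)}\pmod p$: - $p^{2e-1}-p^{e-1}\frac{q-1}{2\ell^k}$ : $p-1$ - $p^{2e-2}(p-1)-p^{e-1}\sqrt q+p^{e-1}\frac{\sqrt q+1}{2\ell^k}$ : $(p-1)\frac{q-1}{2\ell^k}$ - $p^{2e-2}(p-1)+p^{e-1}\frac{\sqrt q+1}{2\ell^k}$ : $(p-1)(2\ell^k-1)\frac{q-1}{2\ell^k}$ - $p^{2e-2}(p-1)$ : $(q-1)+q(q-p)$ and the code is four-weight, except that it is three-weight for $(p,\ell,k)=(5,3,1)$ and $(11,3,1)$. 5. If $u\ne 0$ and either $u\equiv\phi(\ell^k)\equiv\ell^{k-1}\pmod p$ or $u\equiv-\phi(\ell^k)\equiv-\ell^{k-1}\pmod p$: - $p^{2e-1}-p^{e-1}\frac{q-1}{2\ell^{k-1}}$ : $p-1$ - $p^{2e-2}(p-1)-p^{e-1}\sqrt q+p^{e-1}\frac{\sqrt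 q+1}{2\ell^{k-1}}$ : $(p-1)\frac{q-1}{2\ell^{k-1}}$ - $p^{2e-2}(p-1)+p^{e-1}\frac{\sqrt q+1}{2\ell^{k-1}}$ : $(p-1)(2\ell^{k-1}-1)\frac{q-1}{2\ell^{k-1}}$ - $p^{2e-2}(p-1)$ : $(q-1)+q(q-p)$ and the code is four-weight. 6. If $u\ne 0$, $u^2\not\equiv\phi(\ell^k)^2\pmod p$ and $u^2\equiv\ell^{2(k-1)}\pmod p$: - $p^{2e-1}-p^{e-1}(\ell-1)\frac{q-1}{2\ell^k}$ : $p-1$ - $p^{2e-2}(p-1)-p^{e-1}\sqrt q+p^{e-1}(\ell-1)\frac{\sqrt q+1}{2\ell^k}$ : $(p-1)(\ell-1)\frac{q-1}{2\ell^k}$ - $p^{2e-2}(p-1)+p^{e-1}(\ell-1)\frac{\sqrt q+1}{2\ell^k}$ : $(p-1)(2\ell^k-\ell+1)\frac{q-1}{2\ell^k}$ - $p^{2e-2}(p-1)$ : $(q-1)+q(q-p)$ and the code is four-weight, except that it is three-weight for $(p,\ell,k)=(5,3,1)$. -/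

import Mathlib

noncomputable section

namespace TraceCode

/-- The set of all `(x, y) ≠ (0, 0)` in `F × F` with `Tr (x + y ^ N) = u`, where `Tr` is the
trace from `F` to the prime field. -/
def definingSet (p : ℕ) (F : Type*) [Field F] [Fintype F] [DecidableEq F] [Algebra (ZMod p) F]
    (N : ℕ) (u : ZMod p) : Finset (F × F) :=
  Finset.univ.filter fun z =>
    z ≠ (0, 0) ∧ Algebra.trace (ZMod p) F (z.1 + z.2 ^ N) = u

/-- The map sending `(γ, δ)` to the word `(Tr (γ x + δ y))`, with coordinates indexed by the
points `(x, y)` of `D`. -/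
def codeword (p : ℕ) {F : Type*} [Field F] [Algebra (ZMod p) F] (D : Finset (F × F)) :
    (F × F) →ₗ[ZMod p] (D → ZMod p) where
  toFun g := fun d => Algebra.trace (ZMod p) F (g.1 * d.1.1 + g.2 * d.1.2)
  map_add' g h := by
    funext d
    simp only [Prod.fst_add, Prod.snd_add, Pi.add_apply, ← map_add]
    congr 1
    ring
  map_smul' a g := by
    funext d
    simp only [Prod.smul_fst, Prod.smul_snd, smul_mul_assoc, ← smul_add, map_smul,
      RingHom.id_apply, Pi.smul_apply]

/-- The linear code `{(Tr (γ x + δ y))_{(x, y) ∈ D} : γ, δ ∈ F}`; its length is `D.card`. -/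
def code (p : ℕ) {F : Type*} [Field F] [Algebra (ZMod p) F] (D : Finset (F × F)) :
    Submodule (ZMod p) (D → ZMod p) :=
  LinearMap.range (codeword p D)

/-- The number `A_w` of codewords of Hamming weight `w`. -/
def weightCount {p : ℕ} {ι : Type*} [Fintype ι] (C : Submodule (ZMod p) (ι → ZMod p))
    (w : ℕ) : ℕ :=
  Set.ncard {c : ι → ZMod p | c ∈ C ∧ hammingNorm c = w}

/-- `C` is a `t`-weight code: exactly `t` positive integers are weights of codewords. -/
def IsWeightCode {p : ℕ} {ι : Type*} [Fintype ι] (t : ℕ)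
    (C : Submodule (ZMod p) (ι → ZMod p)) : Prop :=
  Set.ncard {w : ℕ | 1 ≤ w ∧ weightCount C w ≠ 0} = t

/-- `C` has the weight distribution given by a table of rows `(weight, frequency)`: for every `w`,
the number of codewords of weight `w` is the sum of the frequencies of the rows with weight `w`
(so rows of equal weight are merged, and a row of frequency zero contributes nothing). -/
def HasWeightTable {p : ℕ} {ι : Type*} [Fintype ι] (C : Submodule (ZMod p) (ι → ZMod p))
    (T : List (ℝ × ℝ)) : Prop :=
  ∀ w : ℕ, (weightCount C w : ℝ) = (T.map fun r => if r.1 = (w : ℝ) then r.2 else 0).sum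

end TraceCode

end

/-
Since `p` is a primitive root modulo `2ℓ ^ k`, the square root of `q` is `-1` modulo `2ℓ ^ k`; write
`√q + 1 = 2ℓ ^ k r`, so that `N = (√q - 1) r` and `y ↦ y ^ N` is constant on the punctured lines of
`𝔽_q` over its subfield with `√q` elements. Averaging `Tr (δ y)` over these lines evaluates
`#{y ≠ 0 | Tr (y ^ N - δ y) = u}`, which takes two values when `δ ≠ 0`, according to whether a
certain `2ℓ ^ k`-th root of unity attached to `δ` has trace `u`. The words of `(γ, δ)` with
`γ ∉ 𝔽_p` or `γ = 0 ≠ δ` all have the same weight, and for `γ ∈ 𝔽_p`, `γ ≠ 0`, rescaling reduces to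
`γ = 1`, where the weight is given by this count. So the weight distribution only depends on the
number `n` of `2ℓ ^ k`-th roots of unity of trace `u`. As the powers of `p` run through the units
modulo `ℓ ^ k`, an `ℓ ^ k`-th root of unity has trace `φ(ℓ ^ k)`, `-ℓ ^ (k - 1)` or `0` according to
whether its order is `1`, `ℓ` or a higher power of `ℓ`, which gives `n`. Finally two listed weights
can only coincide when `n r` is `√q / p` or `√q / p + 1`, an arithmetic condition on `p`, `ℓ` and
`k`.
-/

namespace TraceCode

open Finset Module

section Fibres

theorem card_filter_apply_mul_card {V W : Type*} [AddGroup V] [Fintype V] [AddGroup W] [Fintype W]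
    [DecidableEq W] {f : V →+ W} (hf : Function.Surjective f) (w : W) :
    #{v | f v = w} * Fintype.card W = Fintype.card V := by
  have hfibre (w' : W) : #{v | f v = w'} = #{v | f v = w} :=
    AddMonoidHom.card_fiber_eq_of_mem_range f (hf w') (hf w)
  have hsum := card_eq_sum_card_fiberwise (f := f) (s := univ) (t := univ) fun _ _ => mem_univ _
  simp only [hfibre, sum_const, smul_eq_mul, card_univ] at hsum
  rw [mul_comm, ← hsum]

variable {G : Type*} [CommGroup G] [IsCyclic G]

theorem range_powMonoidHom_eq_ker [Finite G] {N M : ℕ} (hNM : N * M = Nat.card G) :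
    (powMonoidHom N : G →* G).range = (powMonoidHom M : G →* G).ker := by
  have hN : 0 < N := Nat.pos_of_mul_pos_right (hNM ▸ Nat.card_pos)
  refine Subgroup.eq_of_le_of_card_ge ?_ (le_of_eq ?_)
  · rintro _ ⟨g, rfl⟩
    rw [MonoidHom.mem_ker, powMonoidHom_apply, powMonoidHom_apply, ← pow_mul, hNM,
      pow_card_eq_one']
  · rw [IsCyclic.card_powMonoidHom_ker, IsCyclic.card_powMonoidHom_range, ← hNM,
      Nat.gcd_mul_left_left, Nat.gcd_mul_right_left, Nat.mul_div_cancel_left _ hN]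

variable [Fintype G] [DecidableEq G]

theorem card_filter_pow_eq_one {d : ℕ} (hd : d ∣ Fintype.card G) : #{g : G | g ^ d = 1} = d := by
  have hker := IsCyclic.card_powMonoidHom_ker (G := G) d
  rw [Nat.card_eq_fintype_card (α := G), Nat.gcd_eq_right hd] at hker
  refine Eq.trans ?_ hker
  rw [← Fintype.card_subtype, ← Nat.card_eq_fintype_card]
  rfl

theorem card_filter_pow_mem {N M : ℕ} (hNM : N * M = Fintype.card G) (P : G → Prop)
    [DecidablePred P] : #{g | P (g ^ N)} = N * #{h | h ^ M = 1 ∧ P h} := by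
  have hfibre (h : G) (hh : h ^ M = 1) : #{g : G | g ^ N = h} = N := by
    have hmem : h ∈ Set.range (powMonoidHom N : G →* G) := by
      rw [← MonoidHom.coe_range,
        range_powMonoidHom_eq_ker (hNM.trans Nat.card_eq_fintype_card.symm)]
      exact hh
    exact (MonoidHom.card_fiber_eq_of_mem_range _ hmem ⟨1, map_one _⟩).trans
      (card_filter_pow_eq_one (Dvd.intro _ hNM))
  rw [mul_comm, card_eq_sum_card_fiberwise (f := fun g : G => g ^ N)
    (t := {h | h ^ M = 1 ∧ P h}) fun g hg => ?_]
  · refine sum_const_nat fun h hh => ?_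
    rw [mem_filter_univ] at hh
    refine Eq.trans (congrArg _ ?_) (hfibre h hh.1)
    ext g
    rw [mem_filter, mem_filter_univ, mem_filter_univ, and_iff_right_iff_imp]
    rintro rfl
    exact hh.2
  · simp only [coe_filter_univ, Set.mem_ofPred_eq, ← pow_mul, hNM, pow_card_eq_one, true_and]
      at hg ⊢
    exact hg

end Fibres

section FiniteFieldPowers

variable {F : Type*} [Field F] [Fintype F] [DecidableEq F]

theorem card_filter_units (P : F → Prop) [DecidablePred P] :
    #{x : Fˣ | P x} = #{y : F | y ≠ 0 ∧ P y} := by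
  refine card_bij (fun x _ => (x : F)) (fun x hx => ?_) (fun _ _ _ _ => Units.ext) fun y hy => ?_
  · simpa using hx
  · simp only [mem_filter_univ] at hy
    exact ⟨Units.mk0 y hy.1, by simpa using hy.2, rfl⟩

theorem card_filter_root_of_unity {d : ℕ} (P : F → Prop) [DecidablePred P] (hd : d ≠ 0) :
    #{x : Fˣ | x ^ d = 1 ∧ P x} = #{ω : F | ω ^ d = 1 ∧ P ω} := by
  simp only [← Units.val_inj, Units.val_pow_eq_pow_val, Units.val_one]
  rw [card_filter_units fun x : F => x ^ d = 1 ∧ P x]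
  congr 1
  ext x
  simp only [mem_filter_univ, and_iff_right_iff_imp]
  rintro ⟨hx, -⟩ rfl
  simp [zero_pow hd] at hx

theorem card_filter_root_of_unity_of_dvd {d : ℕ} (hd : d ∣ Fintype.card F - 1) :
    #{ω : F | ω ^ d = 1} = d := by
  have hd0 : d ≠ 0 := ne_zero_of_dvd_ne_zero (Nat.sub_pos_of_lt Fintype.one_lt_card).ne' hd
  have h := card_filter_root_of_unity (fun _ : F => True) hd0
  simp only [and_true] at h
  rw [← h, card_filter_pow_eq_one (by rwa [Fintype.card_units])]

theorem card_filter_ne_zero_pow_mem {N M : ℕ} (hNM : N * M = Fintype.card F - 1) (P : F → Prop)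
    [DecidablePred P] :
    #{y : F | y ≠ 0 ∧ P (y ^ N)} = N * #{ω : F | ω ^ M = 1 ∧ P ω} := by
  have hM : M ≠ 0 := by
    have := Nat.sub_pos_of_lt (Fintype.one_lt_card (α := F))
    rintro rfl
    omega
  rw [← card_filter_units, ← card_filter_root_of_unity P hM,
    ← card_filter_pow_mem (by rwa [Fintype.card_units]) fun x : Fˣ => P x]
  simp only [Units.val_pow_eq_pow_val]

end FiniteFieldPowers

section Trace

variable {k F : Type*} [Field k] [Field F] [Algebra k F]

theorem traceForm_apply_ne_zero [FiniteDimensional k F] [Algebra.IsSeparable k F] {a : F}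
    (ha : a ≠ 0) : Algebra.traceForm k F a ≠ 0 := fun h =>
  ha ((traceForm_nondegenerate k F).1 a (LinearMap.congr_fun h))

theorem exists_trace_eq_zero_and_trace_mul_ne_zero [FiniteDimensional k F]
    [Algebra.IsSeparable k F] {γ : F} (hγ : γ ∉ Set.range (algebraMap k F)) :
    ∃ x, Algebra.trace k F x = 0 ∧ Algebra.trace k F (γ * x) ≠ 0 := by
  by_contra! hker
  have hspan : Algebra.traceForm k F γ
      ∈ Submodule.span k (Set.range fun _ : Unit => Algebra.trace k F) := by
    refine mem_span_of_iInf_ker_le_ker fun x hx => ?_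
    simp only [Submodule.mem_iInf, LinearMap.mem_ker] at hx ⊢
    exact hker x (hx ())
  rw [Set.range_const, Submodule.mem_span_singleton] at hspan
  obtain ⟨c, hc⟩ := hspan
  have hzero : Algebra.traceForm k F (γ - algebraMap k F c) = 0 := by
    ext x
    rw [Algebra.traceForm_apply, sub_mul, map_sub, ← Algebra.smul_def, map_smul,
      ← Algebra.traceForm_apply, ← hc]
    simp
  exact hγ ⟨c, by_contra fun hne => traceForm_apply_ne_zero (sub_ne_zero.2 (Ne.symm hne)) hzero⟩

variable [Fintype k] [Fintype F] [DecidableEq k]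

theorem card_filter_trace_mul {a : F} (ha : a ≠ 0) (v : k) :
    #{x : F | Algebra.trace k F (a * x) = v} * Fintype.card k = Fintype.card F :=
  card_filter_apply_mul_card (f := (Algebra.traceForm k F a).toAddMonoidHom)
    (LinearMap.surjective (traceForm_apply_ne_zero ha)) v

theorem card_filter_trace_and_trace_mul {γ : F} (hγ : γ ∉ Set.range (algebraMap k F)) (a b : k) :
    #{x : F | Algebra.trace k F x = a ∧ Algebra.trace k F (γ * x) = b} * Fintype.card k ^ 2
      = Fintype.card F := by
  obtain ⟨x₁, h₁, h₁'⟩ := exists_trace_eq_zero_and_trace_mul_ne_zero hγ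
  obtain ⟨x₂, h₂⟩ := Algebra.trace_surjective k F 1
  have hsurj : Function.Surjective ((Algebra.trace k F).prod (Algebra.traceForm k F γ)) := by
    rintro ⟨a, b⟩
    refine ⟨a • x₂ + ((b - a * Algebra.trace k F (γ * x₂)) / Algebra.trace k F (γ * x₁)) • x₁, ?_⟩
    ext
    · simp [h₁, h₂]
    · simp [mul_add, h₁']
  have h := card_filter_apply_mul_card
    (f := ((Algebra.trace k F).prod (Algebra.traceForm k F γ)).toAddMonoidHom) hsurj (a, b)
  rw [Fintype.card_prod, ← sq] at h
  rw [← h]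
  congr 2
  ext x
  simp [Algebra.traceForm_apply]

end Trace

section RootTraces

theorem geom_sum_eq_zero_of_pow_eq_one {R : Type*} [CommRing R] [IsDomain R] {x : R} {n : ℕ}
    (hx : x ≠ 1) (hn : x ^ n = 1) : ∑ i ∈ range n, x ^ i = 0 := by
  have h := geom_sum_mul x n
  rw [hn, sub_self] at h
  exact (mul_eq_zero.1 h).resolve_right (sub_ne_zero.2 hx)

theorem image_pow_mod_eq_filter_coprime {b m : ℕ} (hm : 1 < m)
    (hb : orderOf (b : ZMod m) = m.totient) :
    (range m.totient).image (fun i => b ^ i % m) = {a ∈ range m | m.Coprime a} := by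
  have hpos : 0 < m.totient := Nat.totient_pos.2 (by omega)
  have hcop : b.Coprime m := by
    rw [← ZMod.isUnit_iff_coprime]
    exact (orderOf_pos_iff.1 (hb ▸ hpos)).isUnit
  refine eq_of_subset_of_card_le (fun a ha => ?_) (le_of_eq ?_)
  · obtain ⟨i, -, rfl⟩ := mem_image.1 ha
    rw [mem_filter, mem_range]
    refine ⟨Nat.mod_lt _ (by omega), ?_⟩
    rw [Nat.coprime_iff_gcd_eq_one, Nat.gcd_comm, ← Nat.gcd_rec, Nat.gcd_comm]
    exact hcop.pow_left i
  · rw [card_image_of_injOn, card_range, Nat.totient_eq_card_coprime]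
    intro i hi j hj hij
    rw [coe_range, ← hb] at hi hj
    refine pow_injOn_Iio_orderOf hi hj ?_
    simpa using (ZMod.natCast_eq_natCast_iff' (b ^ i) (b ^ j) m).2 hij

theorem sum_coprime_prime_pow {R : Type*} [AddCommGroup R] {ℓ : ℕ} (hℓ : ℓ.Prime) (j : ℕ)
    (f : ℕ → R) :
    ∑ a ∈ range (ℓ ^ (j + 1)) with (ℓ ^ (j + 1)).Coprime a, f a
      = ∑ a ∈ range (ℓ ^ (j + 1)), f a - ∑ b ∈ range (ℓ ^ j), f (ℓ * b) := by
  have himage : {a ∈ range (ℓ ^ (j + 1)) | ¬ (ℓ ^ (j + 1)).Coprime a}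
      = (range (ℓ ^ j)).image (fun b => ℓ * b) := by
    ext a
    simp only [mem_filter, mem_range, mem_image, Nat.coprime_pow_left_iff (Nat.succ_pos j),
      hℓ.coprime_iff_not_dvd, not_not]
    rw [pow_succ']
    constructor
    · rintro ⟨ha, b, rfl⟩
      exact ⟨b, lt_of_mul_lt_mul_left' ha, rfl⟩
    · rintro ⟨b, hb, rfl⟩
      exact ⟨Nat.mul_lt_mul_of_pos_left hb hℓ.pos, dvd_mul_right _ _⟩
  rw [← sum_filter_add_sum_filter_not (range (ℓ ^ (j + 1))) (fun a => (ℓ ^ (j + 1)).Coprime a),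
    himage, sum_image fun x _ y _ h => Nat.eq_of_mul_eq_mul_left hℓ.pos h, add_sub_cancel_right]

variable {k F : Type*} [Field k] [Field F] [Algebra k F]

theorem trace_one : Algebra.trace k F 1 = (finrank k F : k) := by
  rw [← map_one (algebraMap k F), Algebra.trace_algebraMap, nsmul_one]

variable [Fintype k] [Finite F]

theorem algebraMap_trace_eq_sum_coprime {m : ℕ} (hm : 1 < m)
    (hk : orderOf (Fintype.card k : ZMod m) = m.totient) (hF : finrank k F = m.totient) {ω : F}
    (hω : ω ^ m = 1) :
    algebraMap k F (Algebra.trace k F ω) = ∑ a ∈ range m with m.Coprime a, ω ^ a := by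
  rw [FiniteField.algebraMap_trace_eq_sum_pow, hF, Nat.card_eq_fintype_card,
    ← image_pow_mod_eq_filter_coprime hm hk, sum_image]
  · refine sum_congr rfl fun i _ => ?_
    rw [← Nat.mod_add_div (Fintype.card k ^ i) m, pow_add, pow_mul, hω, one_pow, mul_one,
      Nat.mod_add_div]
  · refine card_image_iff.1 ?_
    rw [image_pow_mod_eq_filter_coprime hm hk, card_range, Nat.totient_eq_card_coprime]

variable {ℓ j : ℕ}

theorem algebraMap_trace_of_pow_prime_pow_eq_one (hℓ : ℓ.Prime)
    (hk : orderOf (Fintype.card k : ZMod (ℓ ^ (j + 1))) = (ℓ ^ (j + 1)).totient)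
    (hF : finrank k F = (ℓ ^ (j + 1)).totient) {ω : F} (hω : ω ^ ℓ ^ (j + 1) = 1) :
    algebraMap k F (Algebra.trace k F ω)
      = ∑ a ∈ range (ℓ ^ (j + 1)), ω ^ a - ∑ b ∈ range (ℓ ^ j), (ω ^ ℓ) ^ b := by
  simp_rw [← pow_mul]
  rw [algebraMap_trace_eq_sum_coprime (Nat.one_lt_pow j.succ_ne_zero hℓ.one_lt) hk hF hω,
    sum_coprime_prime_pow hℓ]

theorem trace_of_pow_prime_eq_one (hℓ : ℓ.Prime)
    (hk : orderOf (Fintype.card k : ZMod (ℓ ^ (j + 1))) = (ℓ ^ (j + 1)).totient)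
    (hF : finrank k F = (ℓ ^ (j + 1)).totient) {ω : F} (hω : ω ^ ℓ = 1) (h1 : ω ≠ 1) :
    Algebra.trace k F ω = -(ℓ : k) ^ j := by
  have hω' : ω ^ ℓ ^ (j + 1) = 1 := by rw [pow_succ', pow_mul, hω, one_pow]
  apply (algebraMap k F).injective
  rw [algebraMap_trace_of_pow_prime_pow_eq_one hℓ hk hF hω', geom_sum_eq_zero_of_pow_eq_one h1 hω',
    hω]
  simp

theorem trace_of_pow_prime_ne_one (hℓ : ℓ.Prime)
    (hk : orderOf (Fintype.card k : ZMod (ℓ ^ (j + 1))) = (ℓ ^ (j + 1)).totient)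
    (hF : finrank k F = (ℓ ^ (j + 1)).totient) {ω : F} (hω : ω ^ ℓ ^ (j + 1) = 1)
    (h1 : ω ^ ℓ ≠ 1) : Algebra.trace k F ω = 0 := by
  have hω1 : ω ≠ 1 := by
    rintro rfl
    exact h1 (one_pow ℓ)
  apply (algebraMap k F).injective
  rw [algebraMap_trace_of_pow_prime_pow_eq_one hℓ hk hF hω, geom_sum_eq_zero_of_pow_eq_one hω1 hω,
    geom_sum_eq_zero_of_pow_eq_one h1 (by rw [← pow_mul, ← pow_succ', hω]), sub_zero, map_zero]

end RootTraces

section RootTraceCount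

/-- The number of `m`-th roots of unity in `F` whose trace to `k` is `u`. -/
noncomputable def rootTraceCount (k F : Type*) [Field k] [DecidableEq k] [Field F] [Fintype F]
    [DecidableEq F] [Algebra k F] (m : ℕ) (u : k) : ℕ :=
  #{ω : F | ω ^ m = 1 ∧ Algebra.trace k F ω = u}

variable {k F : Type*} [Field k] [DecidableEq k] [Field F] [Fintype F] [DecidableEq F]
  [Algebra k F]

theorem rootTraceCount_two_mul_of_odd (h2 : ringChar k ≠ 2) {m : ℕ} (hm : Odd m) (u : k) :
    rootTraceCount k F (2 * m) u = rootTraceCount k F m u + rootTraceCount k F m (-u) := by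
  have hneg : #{ω : F | ω ^ m = -1 ∧ Algebra.trace k F ω = u} = rootTraceCount k F m (-u) := by
    refine card_nbij' Neg.neg Neg.neg (fun x hx => ?_) (fun x hx => ?_) (fun x _ => neg_neg x)
      fun x _ => neg_neg x
    all_goals
      simp only [coe_filter_univ, Set.mem_ofPred_eq] at hx ⊢
      simp [hm.neg_pow, hx.1, hx.2]
  have hne : (1 : F) ≠ -1 := fun h => Ring.neg_one_ne_one_of_char_ne_two
    (by rwa [← Algebra.ringChar_eq k F]) h.symm
  rw [← hneg, rootTraceCount, rootTraceCount, ← card_union_of_disjoint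
    (disjoint_filter.2 fun ω _ h h' => hne (h.1.symm.trans h'.1)), ← filter_or]
  simp only [mul_comm 2 m, pow_mul, sq_eq_one_iff, or_and_right]

theorem rootTraceCount_prime_pow [Fintype k] {ℓ j : ℕ} (hℓ : ℓ.Prime)
    (hk : orderOf (Fintype.card k : ZMod (ℓ ^ (j + 1))) = (ℓ ^ (j + 1)).totient)
    (hF : finrank k F = (ℓ ^ (j + 1)).totient) (hdvd : ℓ ^ (j + 1) ∣ Fintype.card F - 1) (u : k) :
    rootTraceCount k F (ℓ ^ (j + 1)) u
      = (if ((ℓ ^ (j + 1)).totient : k) = u then 1 else 0)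
        + (if -(ℓ : k) ^ j = u then ℓ - 1 else 0)
        + (if 0 = u then ℓ ^ (j + 1) - ℓ else 0) := by
  set A : Finset F := {ω | ω ^ ℓ ^ (j + 1) = 1} with hA
  set B : Finset F := {ω | ω ^ ℓ = 1} with hB
  have hcardA : #A = ℓ ^ (j + 1) := card_filter_root_of_unity_of_dvd hdvd
  have hcardB : #B = ℓ :=
    card_filter_root_of_unity_of_dvd ((dvd_pow_self ℓ j.succ_ne_zero).trans hdvd)
  have hBA : B ⊆ A := fun ω hω => by
    simp only [hA, hB, mem_filter_univ] at hω ⊢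
    rw [pow_succ', pow_mul, hω, one_pow]
  have hone : (1 : F) ∈ B := by simp [hB]
  have hsum_erase : (∑ ω ∈ B.erase 1, if Algebra.trace k F ω = u then 1 else 0)
      = if -(ℓ : k) ^ j = u then ℓ - 1 else 0 := by
    rw [sum_congr rfl (g := fun _ => if -(ℓ : k) ^ j = u then 1 else 0) fun ω hω => ?_]
    · rw [sum_const, card_erase_of_mem hone, hcardB, smul_eq_mul, mul_ite, mul_one, mul_zero]
    · simp only [hB, mem_erase, mem_filter_univ] at hω
      rw [trace_of_pow_prime_eq_one hℓ hk hF hω.2 hω.1]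
  have hsum_sdiff : (∑ ω ∈ A \ B, if Algebra.trace k F ω = u then 1 else 0)
      = if 0 = u then ℓ ^ (j + 1) - ℓ else 0 := by
    rw [sum_congr rfl (g := fun _ => if 0 = u then 1 else 0) fun ω hω => ?_]
    · rw [sum_const, card_sdiff_of_subset hBA, hcardA, hcardB, smul_eq_mul, mul_ite, mul_one,
        mul_zero]
    · simp only [hA, hB, mem_sdiff, mem_filter_univ] at hω
      rw [trace_of_pow_prime_ne_one hℓ hk hF hω.1 hω.2]
  rw [rootTraceCount, ← filter_filter, card_filter, ← sum_sdiff hBA, ← add_sum_erase _ _ hone,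
    hsum_erase, hsum_sdiff, trace_one, hF, add_comm]

end RootTraceCount

section LineCounting

variable {k K F : Type*} [Field k] [Field K] [Field F] [Algebra k F] [Algebra K F]

theorem exists_trace_eq_zero_iff_smul [FiniteDimensional K F] [Algebra.IsSeparable K F]
    (h2 : finrank K F = 2) :
    ∃ z : F, z ≠ 0 ∧ ∀ y, Algebra.trace K F y = 0 ↔ ∃ c : K, c • z = y := by
  have hker : finrank K (Algebra.trace K F).ker = 1 := by
    have h := (Algebra.trace K F).finrank_range_add_finrank_ker
    rw [LinearMap.range_eq_top.2 (Algebra.trace_surjective K F), finrank_top, finrank_self, h2] at h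
    omega
  obtain ⟨z, hz, hspan⟩ := finrank_eq_one_iff'.1 hker
  refine ⟨z, fun h => hz (Subtype.ext h), fun y => ⟨fun hy => ?_, ?_⟩⟩
  · obtain ⟨c, hc⟩ := hspan ⟨y, hy⟩
    exact ⟨c, congrArg Subtype.val hc⟩
  · rintro ⟨c, rfl⟩
    exact (Algebra.trace K F).ker.smul_mem c z.2

theorem trace_smul_eq [Algebra k K] [IsScalarTower k K F]
    [FiniteDimensional k K] [FiniteDimensional K F] (c : K) (y : F) :
    Algebra.trace k F (c • y) = Algebra.trace k K (c * Algebra.trace K F y) := by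
  rw [← Algebra.trace_trace (S := K), map_smul, smul_eq_mul]

theorem sum_card_filter_sub_trace_smul [Fintype K] [Fintype F] [DecidableEq k] [DecidableEq F]
    {f : F → k} (hf : ∀ c : K, c ≠ 0 → ∀ y, f (c • y) = f y) (u : k) :
    ∑ c : K, #{y : F | y ≠ 0 ∧ f y - Algebra.trace k F (c • y) = u}
      = (Fintype.card K - 1) * #{y : F | y ≠ 0 ∧ f y - Algebra.trace k F y = u}
        + #{y : F | y ≠ 0 ∧ f y = u} := by
  classical
  have hscale (c : K) (hc : c ∈ univ.erase 0) :
      #{y : F | y ≠ 0 ∧ f y - Algebra.trace k F (c • y) = u}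
        = #{y : F | y ≠ 0 ∧ f y - Algebra.trace k F y = u} := by
    have hc0 := ne_of_mem_erase hc
    refine card_nbij' (c • ·) (c⁻¹ • ·) (fun y hy => ?_) (fun y hy => ?_)
      (fun y _ => inv_smul_smul₀ hc0 y) fun y _ => smul_inv_smul₀ hc0 y
    · simpa [hc0, hf c hc0] using hy
    · simpa [hc0, hf c⁻¹ (inv_ne_zero hc0)] using hy
  rw [← sum_erase_add _ _ (mem_univ 0), sum_congr rfl hscale, sum_const,
    card_erase_of_mem (mem_univ _), card_univ, smul_eq_mul]
  simp

theorem card_filter_trace_eq_zero [Fintype K] [DecidableEq K] [Fintype F] [DecidableEq F] {z : F}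
    (hz : z ≠ 0) (hker : ∀ y, Algebra.trace K F y = 0 ↔ ∃ c : K, c • z = y) :
    #{y : F | y ≠ 0 ∧ Algebra.trace K F y = 0} = Fintype.card K - 1 := by
  have himage : ({y : F | y ≠ 0 ∧ Algebra.trace K F y = 0} : Finset F)
      = (univ.erase (0 : K)).image (· • z) := by
    ext y
    simp only [mem_filter_univ, hker, mem_image, mem_erase, mem_univ, and_true]
    constructor
    · rintro ⟨hy, c, rfl⟩
      exact ⟨c, fun hc => hy (by simp [hc]), rfl⟩
    · rintro ⟨c, hc, rfl⟩
      exact ⟨smul_ne_zero hc hz, c, rfl⟩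
  rw [himage, card_image_of_injective _ (smul_left_injective K hz), card_erase_of_mem (mem_univ _),
    card_univ]

theorem card_filter_trace_ne_zero [Fintype K] [DecidableEq K] [Fintype F] [DecidableEq F] {z : F}
    (hz : z ≠ 0) (hker : ∀ y, Algebra.trace K F y = 0 ↔ ∃ c : K, c • z = y)
    (hcard : Fintype.card F = Fintype.card K ^ 2) :
    #{y : F | y ≠ 0 ∧ Algebra.trace K F y ≠ 0} = (Fintype.card K - 1) * Fintype.card K := by
  have hsplit := card_filter_add_card_filter_not (s := ({y : F | y ≠ 0} : Finset F))
    (fun y => Algebra.trace K F y = 0)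
  rw [filter_filter, filter_filter, card_filter_trace_eq_zero hz hker, filter_ne' univ,
    card_erase_of_mem (mem_univ _), card_univ, hcard] at hsplit
  obtain ⟨Q, hQ⟩ : ∃ Q, Fintype.card K = Q + 1 := ⟨_, (Nat.succ_pred Fintype.card_ne_zero).symm⟩
  rw [hQ, Nat.add_sub_cancel, show (Q + 1) ^ 2 - 1 = Q + Q * (Q + 1) by ring_nf; omega] at hsplit
  rw [hQ, Nat.add_sub_cancel]
  exact Nat.add_left_cancel hsplit

variable [Algebra k K] [IsScalarTower k K F] [Fintype K] [DecidableEq k]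

theorem card_filter_trace_smul_of_trace_eq_zero [Finite F] {y : F}
    (hy : Algebra.trace K F y = 0) (v : k) :
    #{c : K | Algebra.trace k F (c • y) = v} = if v = 0 then Fintype.card K else 0 := by
  simp only [trace_smul_eq (k := k), hy, mul_zero, map_zero, eq_comm (a := (0 : k)), filter_const,
    apply_ite card, card_univ, card_empty]

variable [Fintype k]

theorem card_filter_trace_smul_of_trace_ne_zero [Finite F] {y : F}
    (hy : Algebra.trace K F y ≠ 0) (v : k) :
    #{c : K | Algebra.trace k F (c • y) = v} * Fintype.card k = Fintype.card K := by
  simp only [trace_smul_eq (k := k), mul_comm _ (Algebra.trace K F y)]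
  exact card_filter_trace_mul hy v

variable [Fintype F] [DecidableEq F]

theorem sum_card_filter_trace_smul {T : ℕ} (hcard : Fintype.card F = Fintype.card K ^ 2)
    (hT : T * Fintype.card k = Fintype.card K) {f : F → k}
    (hf : ∀ c : K, c ≠ 0 → ∀ y, f (c • y) = f y) (u : k) {z : F} (hz : z ≠ 0)
    (hker : ∀ y, Algebra.trace K F y = 0 ↔ ∃ c : K, c • z = y) :
    ∑ y : F with y ≠ 0, #{c : K | Algebra.trace k F (c • y) = f y - u}
      = (Fintype.card K - 1) * (if f z = u then Fintype.card K else 0)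
        + (Fintype.card K - 1) * Fintype.card K * T := by
  classical
  rw [← sum_filter_add_sum_filter_not _ (fun y => Algebra.trace K F y = 0), filter_filter,
    filter_filter, ← card_filter_trace_ne_zero hz hker hcard, ← card_filter_trace_eq_zero hz hker]
  congr 1 <;> refine sum_const_nat fun y hy => ?_ <;> obtain ⟨hy0, hy⟩ := (mem_filter_univ y).1 hy
  · obtain ⟨c, rfl⟩ := (hker y).1 hy
    rw [card_filter_trace_smul_of_trace_eq_zero hy, hf c (fun hc => hy0 (by simp [hc]))]
    simp only [sub_eq_zero]
  · exact Nat.eq_of_mul_eq_mul_right Fintype.card_pos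
      ((card_filter_trace_smul_of_trace_ne_zero hy _).trans hT.symm)

-- Summing over all `K`-multiples of the linear form `Tr` and exchanging the order of summation
-- replaces each `y` by the `K`-line it spans, on which `f` is constant and `Tr` equidistributed
-- unless the line is the kernel of the relative trace.
theorem card_filter_sub_trace_add {T m : ℕ} (hcard : Fintype.card F = Fintype.card K ^ 2)
    (hT : T * Fintype.card k = Fintype.card K) {f : F → k}
    (hf : ∀ c : K, c ≠ 0 → ∀ y, f (c • y) = f y) {u : k}
    (hm : #{y : F | y ≠ 0 ∧ f y = u} = (Fintype.card K - 1) * m) {z : F} (hz : z ≠ 0)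
    (hker : ∀ y, Algebra.trace K F y = 0 ↔ ∃ c : K, c • z = y) :
    #{y : F | y ≠ 0 ∧ f y - Algebra.trace k F y = u} + m
      = Fintype.card K * T + if f z = u then Fintype.card K else 0 := by
  have hswap : ∑ c : K, #{y : F | y ≠ 0 ∧ f y - Algebra.trace k F (c • y) = u}
      = ∑ y : F with y ≠ 0, #{c : K | Algebra.trace k F (c • y) = f y - u} := by
    have hiff (c : K) (y : F) : f y - Algebra.trace k F (c • y) = u
        ↔ Algebra.trace k F (c • y) = f y - u := by
      rw [sub_eq_iff_eq_add, eq_sub_iff_add_eq', eq_comm]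
    simp_rw [← filter_filter, hiff]
    exact sum_card_bipartiteAbove_eq_sum_card_bipartiteBelow _
  rw [sum_card_filter_sub_trace_smul hf u, hm, sum_card_filter_trace_smul hcard hT hf u hz hker,
    ← mul_add, mul_assoc, ← mul_add] at hswap
  rw [Nat.eq_of_mul_eq_mul_left (Nat.sub_pos_of_lt Fintype.one_lt_card) hswap, add_comm]

end LineCounting

section TracePointCount

/-- The number of `y ≠ 0` in `F` with `Tr (y ^ N - δ * y) = u`; it determines the weight of the
codeword of `(1, δ)`. -/
noncomputable def tracePointCount (k F : Type*) [Field k] [DecidableEq k] [Field F] [Fintype F]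
    [DecidableEq F] [Algebra k F] (N : ℕ) (u : k) (δ : F) : ℕ :=
  #{y : F | y ≠ 0 ∧ Algebra.trace k F (y ^ N - δ * y) = u}

theorem card_filter_ne_zero_mul_left {F : Type*} [Field F] [Fintype F] [DecidableEq F] {a : F}
    (ha : a ≠ 0) (P : F → Prop) [DecidablePred P] :
    #{y : F | y ≠ 0 ∧ P (a * y)} = #{y : F | y ≠ 0 ∧ P y} := by
  refine card_nbij' (a * ·) (a⁻¹ * ·) (fun y hy => ?_) (fun y hy => ?_)
    (fun y _ => inv_mul_cancel_left₀ ha y) fun y _ => mul_inv_cancel_left₀ ha y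
  · simpa [ha] using hy
  · simpa [ha] using hy

theorem card_filter_ne_zero_inv_mul {F : Type*} [Field F] [Fintype F] [DecidableEq F] {z : F}
    (hz : z ≠ 0) (P : F → Prop) [DecidablePred P] :
    #{y : F | y ≠ 0 ∧ P (y⁻¹ * z)} = #{y : F | y ≠ 0 ∧ P y} := by
  refine card_nbij' (·⁻¹ * z) (z * ·⁻¹) (fun y hy => ?_) (fun y hy => ?_) (fun y _ => ?_)
    fun y _ => ?_
  · simpa [hz] using hy
  · simpa [hz] using hy
  · simp [hz]
  · simp [hz]

variable {k F : Type*} [Field k] [DecidableEq k] [Field F] [Fintype F] [DecidableEq F]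
  [Algebra k F] {N M : ℕ}

theorem tracePointCount_zero (hNM : N * M = Fintype.card F - 1) (u : k) :
    tracePointCount k F N u 0 = N * rootTraceCount k F M u := by
  simp only [tracePointCount, zero_mul, sub_zero]
  exact card_filter_ne_zero_pow_mem hNM fun x => Algebra.trace k F x = u

theorem tracePointCount_add_eq {K : Type*} [Field K] [Fintype k] [Fintype K] [Algebra k K]
    [Algebra K F] [IsScalarTower k K F] {T r : ℕ} (hcard : Fintype.card F = Fintype.card K ^ 2)
    (hT : T * Fintype.card k = Fintype.card K) (hN : N = (Fintype.card K - 1) * r)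
    (hNM : N * M = Fintype.card F - 1) (u : k) {z : F} (hz : z ≠ 0)
    (hker : ∀ y, Algebra.trace K F y = 0 ↔ ∃ c : K, c • z = y) {δ : F} (hδ : δ ≠ 0) :
    tracePointCount k F N u δ + rootTraceCount k F M u * r = Fintype.card K * T
      + if Algebra.trace k F ((δ⁻¹ * z) ^ N) = u then Fintype.card K else 0 := by
  have hδ' : δ⁻¹ ≠ 0 := inv_ne_zero hδ
  have hcount : #{y : F | y ≠ 0 ∧ Algebra.trace k F ((δ⁻¹ * y) ^ N) = u}
      = (Fintype.card K - 1) * (rootTraceCount k F M u * r) := by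
    rw [card_filter_ne_zero_mul_left hδ' fun y => Algebra.trace k F (y ^ N) = u,
      card_filter_ne_zero_pow_mem hNM fun x => Algebra.trace k F x = u, hN, rootTraceCount]
    ring
  have hinv (c : K) (hc : c ≠ 0) (y : F) : (δ⁻¹ * c • y) ^ N = (δ⁻¹ * y) ^ N := by
    rw [mul_smul_comm, smul_pow, hN, pow_mul c, FiniteField.pow_card_sub_one_eq_one c hc, one_pow,
      one_smul]
  rw [← card_filter_sub_trace_add hcard hT
    (f := fun y => Algebra.trace k F ((δ⁻¹ * y) ^ N)) (fun c hc y => by rw [hinv c hc]) hcount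
    hz hker, tracePointCount, ← card_filter_ne_zero_mul_left hδ']
  simp only [map_sub, mul_inv_cancel_left₀ hδ]

end TracePointCount

section QuadraticSubfield

variable {p : ℕ} [Fact p.Prime] {F : Type*} [Field F] [Fintype F] [Algebra (ZMod p) F]

theorem finrank_eq_of_card_eq {e : ℕ} (hF : Fintype.card F = p ^ e) : finrank (ZMod p) F = e :=
  Nat.pow_right_injective (Fact.out : p.Prime).two_le
    ((FiniteField.pow_finrank_eq_card p F).trans hF)

variable [DecidableEq F] {N M s r : ℕ}

theorem exists_tracePointCount_add_eq (hF : Fintype.card F = p ^ (2 * (s + 1)))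
    (hN : N = (p ^ (s + 1) - 1) * r) (hNM : N * M = Fintype.card F - 1) (u : ZMod p) :
    ∃ z : F, z ≠ 0 ∧ ∀ δ : F, δ ≠ 0 →
      tracePointCount (ZMod p) F N u δ + rootTraceCount (ZMod p) F M u * r = p ^ (2 * s + 1)
        + if Algebra.trace (ZMod p) F ((δ⁻¹ * z) ^ N) = u then p ^ (s + 1) else 0 := by
  let K := GaloisField p (s + 1)
  have hKrank : finrank (ZMod p) K = s + 1 := GaloisField.finrank p s.succ_ne_zero
  have hFrank := finrank_eq_of_card_eq hF
  obtain ⟨φ⟩ := FiniteField.nonempty_algHom_of_finrank_dvd (F := ZMod p) (K := K) (L := F)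
    (by rw [hKrank, hFrank]; exact dvd_mul_left _ _)
  let _ : Algebra K F := φ.toRingHom.toAlgebra
  have : IsScalarTower (ZMod p) K F := IsScalarTower.of_algebraMap_eq' φ.comp_algebraMap.symm
  let _ : Fintype K := Fintype.ofFinite K
  have hK : Fintype.card K = p ^ (s + 1) := by
    rw [← FiniteField.pow_finrank_eq_card p K, hKrank]
  have hcard : Fintype.card F = Fintype.card K ^ 2 := by rw [hF, hK, ← pow_mul, mul_comm]
  have hrank : finrank K F = 2 := by
    have h := finrank_mul_finrank (ZMod p) K F
    rw [hKrank, hFrank, mul_comm] at h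
    exact Nat.eq_of_mul_eq_mul_right s.succ_pos h
  have hT : p ^ s * Fintype.card (ZMod p) = Fintype.card K := by rw [ZMod.card, hK, pow_succ]
  obtain ⟨z, hz, hker⟩ := exists_trace_eq_zero_iff_smul hrank
  refine ⟨z, hz, fun δ hδ => ?_⟩
  rw [← hK] at hN ⊢
  rw [tracePointCount_add_eq hcard hT hN hNM u hz hker hδ, hK, ← pow_add]
  congr 2
  ring

end QuadraticSubfield

section Words

theorem card_filter_ne_and_add {α : Type*} [Fintype α] [DecidableEq α] (a : α) (P : α → Prop)
    [DecidablePred P] {c : Prop} [Decidable c] (hc : P a ↔ c) :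
    #{x | x ≠ a ∧ P x} + (if c then 1 else 0) = #{x | P x} := by
  have herase : ({x | x ≠ a ∧ P x} : Finset α) = ({x | P x} : Finset α).erase a := by
    ext x
    simp
  rw [herase]
  split_ifs with h
  · exact card_erase_add_one (by simpa [hc] using h)
  · rw [add_zero, erase_eq_of_notMem (by simpa [hc] using h)]

variable {p : ℕ} [Fact p.Prime] {F : Type*} [Field F] [Fintype F] [Algebra (ZMod p) F] {N P : ℕ}

theorem card_filter_trace_mul_eq (hP : P * p = Fintype.card F) {a : F} (ha : a ≠ 0) (v : ZMod p) :
    #{x : F | Algebra.trace (ZMod p) F (a * x) = v} = P := by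
  have h := card_filter_trace_mul ha v
  rw [ZMod.card, ← hP] at h
  exact Nat.eq_of_mul_eq_mul_right (Fact.out : p.Prime).pos h

theorem hammingNorm_codeword_add {F : Type*} [Field F] [Algebra (ZMod p) F]
    (D : Finset (F × F)) (γ δ : F) :
    hammingNorm (codeword p D (γ, δ))
      + #{z ∈ D | Algebra.trace (ZMod p) F (γ * z.1 + δ * z.2) = 0} = #D := by
  have hnorm : hammingNorm (codeword p D (γ, δ))
      = #{z ∈ D | ¬ Algebra.trace (ZMod p) F (γ * z.1 + δ * z.2) = 0} := by
    simp only [hammingNorm, card_filter]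
    exact sum_coe_sort D fun z => if Algebra.trace (ZMod p) F (γ * z.1 + δ * z.2) ≠ 0 then 1 else 0
  rw [hnorm, add_comm, card_filter_add_card_filter_not]

theorem sum_card_filter_trace_eq_and (hP : P * p = Fintype.card F) (v : F → ZMod p) (c : F → Prop)
    [DecidablePred c] :
    ∑ y : F, #{x : F | Algebra.trace (ZMod p) F x = v y ∧ c y} = #{y | c y} * P := by
  rw [card_filter, sum_mul]
  refine sum_congr rfl fun y _ => ?_
  by_cases hy : c y
  · simpa [hy] using card_filter_trace_mul_eq hP (one_ne_zero (α := F)) (v y)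
  · simp [hy]

variable [DecidableEq F] {u : ZMod p}

theorem card_filter_definingSet_add (hN : N ≠ 0) (R : F × F → Prop) [DecidablePred R]
    (hR : R (0, 0)) :
    #{z ∈ definingSet p F N u | R z} + (if u = 0 then 1 else 0)
      = ∑ y : F, #{x : F | Algebra.trace (ZMod p) F x = u - Algebra.trace (ZMod p) F (y ^ N)
          ∧ R (x, y)} := by
  have horigin := card_filter_ne_and_add ((0, 0) : F × F)
    (fun z => Algebra.trace (ZMod p) F (z.1 + z.2 ^ N) = u ∧ R z) (c := u = 0)
    (by simp [hN, hR, eq_comm])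
  simp only [definingSet, filter_filter, and_assoc, horigin, eq_sub_iff_add_eq, ← map_add]
  simp only [card_filter, Fintype.sum_prod_type_right]

theorem card_definingSet_add (hN : N ≠ 0) (hP : P * p = Fintype.card F) :
    #(definingSet p F N u) + (if u = 0 then 1 else 0) = P * Fintype.card F := by
  have h := card_filter_definingSet_add (u := u) hN (fun _ : F × F => True) trivial
  rwa [filter_true, sum_card_filter_trace_eq_and hP, filter_true, card_univ, mul_comm] at h

theorem hammingNorm_codeword_add_sum (hN : N ≠ 0) (hP : P * p = Fintype.card F) (γ δ : F) :
    hammingNorm (codeword p (definingSet p F N u) (γ, δ))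
      + ∑ y : F, #{x : F | Algebra.trace (ZMod p) F x = u - Algebra.trace (ZMod p) F (y ^ N)
          ∧ Algebra.trace (ZMod p) F (γ * x) = -Algebra.trace (ZMod p) F (δ * y)}
      = P * Fintype.card F := by
  have h := card_filter_definingSet_add (u := u) hN
    (fun z : F × F => Algebra.trace (ZMod p) F (γ * z.1 + δ * z.2) = 0) (by simp)
  rw [← card_definingSet_add (u := u) hN hP, ← hammingNorm_codeword_add (p := p) _ γ δ, add_assoc,
    h]
  simp only [map_add, ← eq_neg_iff_add_eq_zero]

theorem hammingNorm_codeword_of_notMem_range (hN : N ≠ 0) (hP : P * p = Fintype.card F) {γ : F}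
    (hγ : γ ∉ Set.range (algebraMap (ZMod p) F)) (δ : F) :
    (hammingNorm (codeword p (definingSet p F N u) (γ, δ)) : ℝ) = P * (Fintype.card F - P) := by
  have hp : 0 < p := (Fact.out : p.Prime).pos
  have hfibre (a b : ZMod p) : #{x : F | Algebra.trace (ZMod p) F x = a
      ∧ Algebra.trace (ZMod p) F (γ * x) = b} * p = P := by
    refine Nat.eq_of_mul_eq_mul_right hp ?_
    rw [mul_assoc, ← sq, hP, ← card_filter_trace_and_trace_mul (k := ZMod p) hγ a b, ZMod.card]
  have hsum := hammingNorm_codeword_add_sum (u := u) hN hP γ δ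
  have hzeros : ∑ y : F, #{x : F | Algebra.trace (ZMod p) F x = u - Algebra.trace (ZMod p) F (y ^ N)
      ∧ Algebra.trace (ZMod p) F (γ * x) = -Algebra.trace (ZMod p) F (δ * y)} = P * P := by
    refine Nat.eq_of_mul_eq_mul_right hp ?_
    simp only [sum_mul, hfibre, sum_const, card_univ, smul_eq_mul, ← hP]
    ring
  rw [hzeros] at hsum
  rify at hsum
  linear_combination hsum

theorem hammingNorm_codeword_zero_left (hN : N ≠ 0) (hP : P * p = Fintype.card F) {δ : F}
    (hδ : δ ≠ 0) :
    (hammingNorm (codeword p (definingSet p F N u) (0, δ)) : ℝ) = P * (Fintype.card F - P) := by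
  have hsum := hammingNorm_codeword_add_sum (u := u) hN hP 0 δ
  simp only [zero_mul, map_zero, zero_eq_neg, sum_card_filter_trace_eq_and hP,
    card_filter_trace_mul_eq hP hδ] at hsum
  rify at hsum
  linear_combination hsum

theorem hammingNorm_codeword_algebraMap (hN : N ≠ 0) (hP : P * p = Fintype.card F) {c : ZMod p}
    (hc : c ≠ 0) (δ : F) :
    (hammingNorm (codeword p (definingSet p F N u)
        (algebraMap (ZMod p) F c, algebraMap (ZMod p) F c * δ)) : ℝ)
      = P * (Fintype.card F - (if u = 0 then 1 else 0 : ℕ) - tracePointCount (ZMod p) F N u δ) := by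
  have hsum := hammingNorm_codeword_add_sum (u := u) hN hP (algebraMap (ZMod p) F c)
    (algebraMap (ZMod p) F c * δ)
  have hzero (x y : F) : (Algebra.trace (ZMod p) F x = u - Algebra.trace (ZMod p) F (y ^ N)
      ∧ Algebra.trace (ZMod p) F (algebraMap (ZMod p) F c * x)
        = -Algebra.trace (ZMod p) F (algebraMap (ZMod p) F c * δ * y))
      ↔ Algebra.trace (ZMod p) F x = u - Algebra.trace (ZMod p) F (y ^ N)
        ∧ Algebra.trace (ZMod p) F (y ^ N - δ * y) = u := by
    refine and_congr_right fun hx => ?_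
    rw [mul_assoc, ← Algebra.smul_def, ← Algebra.smul_def, map_smul, map_smul, ← smul_neg,
      smul_right_injective _ hc |>.eq_iff, hx, map_sub]
    constructor <;> intro h <;> linear_combination -h
  have horigin := card_filter_ne_and_add (0 : F)
    (fun y => Algebra.trace (ZMod p) F (y ^ N - δ * y) = u) (c := u = 0) (by simp [hN, eq_comm])
  simp only [hzero, sum_card_filter_trace_eq_and hP, ← horigin] at hsum
  have hsum' := congrArg (Nat.cast (R := ℝ)) hsum
  push_cast at hsum' ⊢
  rw [tracePointCount]
  linear_combination hsum'

end Words

section WeightRows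

/-- The words of `D` for parameters `(γ, δ) ≠ (0, 0)` are distributed according to the rows
`(weight, frequency)` of `T`. This is encoded by sums over all parameters of an arbitrary function
`G` of the weight, which does not presuppose that different parameters give different words. -/
def HasWeightRows (p : ℕ) {F : Type*} [Field F] [Fintype F] [Algebra (ZMod p) F]
    (D : Finset (F × F)) (T : List (ℝ × ℝ)) : Prop :=
  ∀ G : ℝ → ℝ, ∑ g : F × F, G (hammingNorm (codeword p D g))
    = G 0 + (T.map fun a => a.2 * G a.1).sum

theorem HasWeightTable.perm {p : ℕ} {ι : Type*} [Fintype ι] {C : Submodule (ZMod p) (ι → ZMod p)}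
    {T T' : List (ℝ × ℝ)} (h : HasWeightTable C T) (hT : T.Perm T') : HasWeightTable C T' :=
  fun w => (h w).trans (hT.map _).sum_eq

variable {p : ℕ} [Fact p.Prime] {F : Type*} [Field F] [Algebra (ZMod p) F]

theorem finrank_code_of_injective [Fintype F] {e : ℕ} (hF : Fintype.card F = p ^ e)
    {D : Finset (F × F)} (h : Function.Injective (codeword p D)) :
    finrank (ZMod p) (code p D) = 2 * e := by
  rw [code, LinearMap.finrank_range_of_inj h, finrank_prod, finrank_eq_of_card_eq hF, two_mul]

theorem weightCount_ne_zero_iff [Finite F] {D : Finset (F × F)} {w : ℕ} :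
    weightCount (code p D) w ≠ 0 ↔ ∃ g, hammingNorm (codeword p D g) = w := by
  rw [weightCount, ← Nat.pos_iff_ne_zero, Set.ncard_pos, code]
  simp [Set.Nonempty]

variable [Fintype F] {D : Finset (F × F)} {T : List (ℝ × ℝ)}

theorem HasWeightRows.card_filter_eq (h : HasWeightRows p D T) (x : ℝ) :
    (#{g | (hammingNorm (codeword p D g) : ℝ) = x} : ℝ)
      = (((0, 1) :: T).map fun a => if a.1 = x then a.2 else 0).sum := by
  simpa [sum_boole] using h fun y => if y = x then 1 else 0

theorem HasWeightRows.injective_codeword (h : HasWeightRows p D T) (hT : ∀ a ∈ T, 0 < a.1) :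
    Function.Injective (codeword p D) := by
  have hzero : (T.map fun a => if a.1 = 0 then a.2 else 0).sum = 0 :=
    List.sum_eq_zero fun x hx => by
      obtain ⟨a, ha, rfl⟩ := List.mem_map.1 hx
      rw [if_neg (hT a ha).ne']
  have hone : #{g | (hammingNorm (codeword p D g) : ℝ) = 0} = 1 := by
    have hcard := h.card_filter_eq 0
    simp only [List.map_cons, List.sum_cons, hzero, if_true, add_zero] at hcard
    exact_mod_cast hcard
  obtain ⟨g₀, hg₀⟩ := card_eq_one.1 hone
  have hmem (g) : codeword p D g = 0 ↔ g = g₀ := by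
    simpa using Finset.ext_iff.1 hg₀ g
  refine (injective_iff_map_eq_zero _).2 fun g hg => ?_
  rw [(hmem g).1 hg, ← (hmem 0).1 (map_zero _)]

theorem HasWeightRows.hasWeightTable (h : HasWeightRows p D T) (hT : ∀ a ∈ T, 0 < a.1) :
    HasWeightTable (code p D) ((0, 1) :: T) := by
  intro w
  have hcount : weightCount (code p D) w
      = #{g | (hammingNorm (codeword p D g) : ℝ) = w} := by
    rw [weightCount, ← Set.ncard_coe_finset,
      ← Set.ncard_image_of_injective _ (h.injective_codeword hT)]
    congr 1
    ext c
    simp only [code, LinearMap.mem_range, Nat.cast_inj, coe_filter_univ, Set.mem_image,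
      Set.mem_ofPred_eq]
    constructor
    · rintro ⟨⟨g, rfl⟩, hw⟩
      exact ⟨g, hw, rfl⟩
    · rintro ⟨g, hw, rfl⟩
      exact ⟨⟨g, rfl⟩, hw⟩
  rw [hcount, h.card_filter_eq]

theorem sum_map_ite_eq_zero_iff (hT : ∀ a ∈ T, 0 < a.2) (x : ℝ) :
    (T.map fun a => if a.1 = x then a.2 else 0).sum = 0 ↔ x ∉ T.map Prod.fst := by
  induction T with
  | nil => simp
  | cons a T ih =>
    rw [List.forall_mem_cons] at hT
    have hnonneg : 0 ≤ (T.map fun a => if a.1 = x then a.2 else 0).sum :=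
      List.sum_nonneg <| List.forall_mem_map.2 fun b hb => by
        split_ifs
        exacts [(hT.2 b hb).le, le_rfl]
    have ha : 0 ≤ if a.1 = x then a.2 else 0 := by
      split_ifs
      exacts [hT.1.le, le_rfl]
    rw [List.map_cons, List.sum_cons, add_eq_zero_iff_of_nonneg ha hnonneg, ih hT.2,
      List.map_cons, List.mem_cons, not_or, ite_eq_right_iff, imp_iff_not hT.1.ne', eq_comm]

theorem HasWeightRows.exists_hammingNorm_eq_iff (h : HasWeightRows p D T)
    (hT : ∀ a ∈ T, 0 < a.2) {x : ℝ} (hx : 0 < x) :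
    (∃ g, (hammingNorm (codeword p D g) : ℝ) = x) ↔ x ∈ T.map Prod.fst := by
  have hcard := h.card_filter_eq x
  rw [List.map_cons, List.sum_cons, if_neg hx.ne, zero_add] at hcard
  rw [← not_iff_not, ← sum_map_ite_eq_zero_iff hT, ← hcard, Nat.cast_eq_zero, card_eq_zero,
    filter_eq_empty_iff]
  simp

theorem HasWeightRows.isWeightCode (h : HasWeightRows p D T)
    (hT : ∀ a ∈ T, 0 < a.1 ∧ 0 < a.2) :
    IsWeightCode #(T.map Prod.fst).toFinset (code p D) := by
  have hweight {x : ℝ} (hx : x ∈ T.map Prod.fst) : 0 < x := by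
    obtain ⟨a, ha, rfl⟩ := List.mem_map.1 hx
    exact (hT a ha).1
  have hiff {x : ℝ} (hx : 0 < x) := h.exists_hammingNorm_eq_iff (fun a ha => (hT a ha).2) hx
  rw [IsWeightCode, ← Set.ncard_image_of_injective _ (Nat.cast_injective (R := ℝ)),
    ← Set.ncard_coe_finset]
  congr 1
  ext x
  simp only [Set.mem_image, Set.mem_ofPred_eq, weightCount_ne_zero_iff, mem_coe, List.mem_toFinset]
  constructor
  · rintro ⟨w, ⟨hw, g, hg⟩, rfl⟩
    exact (hiff (Nat.cast_pos.2 hw)).1 ⟨g, congrArg _ hg⟩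
  · intro hx
    obtain ⟨g, hg⟩ := (hiff (hweight hx)).2 hx
    exact ⟨hammingNorm (codeword p D g), ⟨Nat.cast_pos.1 ((hweight hx).trans_eq hg.symm), g, rfl⟩,
      hg⟩

end WeightRows

section Enumerator

theorem mul_eq_pow_sub_one {p s r N M : ℕ} (hM : M * r = p ^ (s + 1) + 1)
    (hN : N = (p ^ (s + 1) - 1) * r) : N * M = p ^ (2 * (s + 1)) - 1 := by
  rw [hN, mul_assoc, mul_comm r, hM, mul_comm, ← Nat.sq_sub_sq (p ^ (s + 1)) 1, ← pow_mul,
    one_pow, mul_comm (s + 1)]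

theorem exponent_ne_zero {p s r N M : ℕ} (hp : 1 < p) (hM : M * r = p ^ (s + 1) + 1)
    (hN : N = (p ^ (s + 1) - 1) * r) : N ≠ 0 := by
  have hr : r ≠ 0 := right_ne_zero_of_mul (hM.trans_ne (Nat.succ_ne_zero _))
  exact hN ▸ mul_ne_zero (Nat.sub_pos_of_lt (Nat.one_lt_pow s.succ_ne_zero hp)).ne' hr

theorem sum_eq_add_of_forall_ne {α : Type*} [Fintype α] {f : α → ℝ} {a : α} {b : ℝ}
    (h : ∀ x, x ≠ a → f x = b) : ∑ x, f x = f a + (Fintype.card α - 1) * b := by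
  classical
  rw [← add_sum_erase _ f (mem_univ a), sum_congr rfl fun x hx => h x (ne_of_mem_erase hx),
    sum_const, card_erase_of_mem (mem_univ a), card_univ, nsmul_eq_mul,
    Nat.cast_sub (Fintype.card_pos_iff.2 ⟨a⟩), Nat.cast_one]

theorem sum_eq_sum_algebraMap_add {k F : Type*} [Field k] [Fintype k] [Field F] [Fintype F]
    [Algebra k F] {f : F → ℝ} {b : ℝ} (h : ∀ x, x ∉ Set.range (algebraMap k F) → f x = b) :
    ∑ x, f x = ∑ c : k, f (algebraMap k F c) + (Fintype.card F - Fintype.card k) * b := by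
  classical
  have hinj := (algebraMap k F).injective
  have hcompl : (#(univ.image (algebraMap k F))ᶜ : ℝ) = Fintype.card F - Fintype.card k := by
    rw [card_compl, Nat.cast_sub (card_le_univ _), card_image_of_injective _ hinj, card_univ]
  rw [← sum_add_sum_compl (univ.image (algebraMap k F)) f, sum_image hinj.injOn, ← hcompl]
  congr 1
  rw [sum_congr rfl fun x hx => h x fun ⟨c, hc⟩ =>
    mem_compl.1 hx (mem_image.2 ⟨c, mem_univ c, hc⟩), sum_const, nsmul_eq_mul]

variable {p : ℕ} [Fact p.Prime] {F : Type*} [Field F] [Fintype F] [DecidableEq F]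
  [Algebra (ZMod p) F] {s M r N n ε : ℕ} {u : ZMod p}

theorem sum_tracePointCount (hF : Fintype.card F = p ^ (2 * (s + 1)))
    (hM : M * r = p ^ (s + 1) + 1) (hN : N = (p ^ (s + 1) - 1) * r)
    (hn : rootTraceCount (ZMod p) F M u = n) (G : ℝ → ℝ) :
    ∑ δ : F, G (tracePointCount (ZMod p) F N u δ)
      = G (n * N) + n * N * G (p ^ (2 * s + 1) + p ^ (s + 1) - n * r)
        + (M - n) * N * G (p ^ (2 * s + 1) - n * r) := by
  have hNM : N * M = Fintype.card F - 1 := by rw [hF, mul_eq_pow_sub_one hM hN]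
  obtain ⟨z, hz, hδ⟩ := exists_tracePointCount_add_eq hF hN hNM u
  rw [hn] at hδ
  have hvalue (δ : F) (h : δ ≠ 0) : G (tracePointCount (ZMod p) F N u δ)
      = if Algebra.trace (ZMod p) F ((δ⁻¹ * z) ^ N) = u
        then G (p ^ (2 * s + 1) + p ^ (s + 1) - n * r)
        else G (p ^ (2 * s + 1) - n * r) := by
    have hcast := congrArg (Nat.cast (R := ℝ)) (hδ δ h)
    push_cast at hcast
    rw [eq_sub_of_add_eq hcast]
    split_ifs <;> simp
  have hcount : #{δ : F | δ ≠ 0 ∧ Algebra.trace (ZMod p) F ((δ⁻¹ * z) ^ N) = u} = n * N := by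
    rw [card_filter_ne_zero_inv_mul hz fun y => Algebra.trace (ZMod p) F (y ^ N) = u,
      card_filter_ne_zero_pow_mem hNM fun x => Algebra.trace (ZMod p) F x = u, mul_comm, ← hn]
    rfl
  have hcompl : (#{δ : F | δ ≠ 0 ∧ ¬ Algebra.trace (ZMod p) F ((δ⁻¹ * z) ^ N) = u} : ℝ)
      = (M - n) * N := by
    have hsplit := card_filter_add_card_filter_not (s := ({δ | δ ≠ 0} : Finset F))
      fun δ => Algebra.trace (ZMod p) F ((δ⁻¹ * z) ^ N) = u
    rw [filter_filter, filter_filter, hcount, filter_ne', card_erase_of_mem (mem_univ 0), card_univ,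
      ← hNM] at hsplit
    have hcast := congrArg (Nat.cast (R := ℝ)) hsplit
    push_cast at hcast
    linear_combination hcast
  rw [← add_sum_erase _ _ (mem_univ (0 : F)), tracePointCount_zero hNM, hn,
    sum_congr rfl fun δ h => hvalue δ (ne_of_mem_erase h), ← filter_ne', sum_ite, sum_const,
    sum_const, filter_filter, filter_filter, nsmul_eq_mul, nsmul_eq_mul, hcount, hcompl]
  push_cast
  rw [mul_comm (N : ℝ) n, add_assoc]

/-- The rows `(weight, frequency)` of the code of `D_u` when `n` of the `M`-th roots of unity have
trace `u`, with `ε = 1` for `u = 0` and `ε = 0` otherwise. -/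
def weightRows (p s M r N n ε : ℕ) : List (ℝ × ℝ) :=
  [((p : ℝ) ^ (2 * s + 1) * (p ^ (2 * (s + 1)) - ε - n * N), (p : ℝ) - 1),
    ((p : ℝ) ^ (2 * s + 1) * (p ^ (2 * (s + 1)) - p ^ (2 * s + 1) - ε - p ^ (s + 1) + n * r),
      (p - 1) * (n * N)),
    ((p : ℝ) ^ (2 * s + 1) * (p ^ (2 * (s + 1)) - p ^ (2 * s + 1) - ε + n * r),
      (p - 1) * ((M - n) * N)),
    ((p : ℝ) ^ (2 * s + 1) * (p ^ (2 * (s + 1)) - p ^ (2 * s + 1)),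
      (p : ℝ) ^ (2 * (s + 1)) - 1 + (p ^ (2 * (s + 1)) - p) * p ^ (2 * (s + 1)))]

theorem sum_hammingNorm_algebraMap (hF : Fintype.card F = p ^ (2 * (s + 1)))
    (hM : M * r = p ^ (s + 1) + 1) (hN : N = (p ^ (s + 1) - 1) * r)
    (hn : rootTraceCount (ZMod p) F M u = n) (hε : (if u = 0 then 1 else 0) = ε)
    {c : ZMod p} (hc : c ≠ 0) (G : ℝ → ℝ) :
    ∑ δ : F, G (hammingNorm (codeword p (definingSet p F N u) (algebraMap (ZMod p) F c, δ)))
      = G (p ^ (2 * s + 1) * (p ^ (2 * (s + 1)) - ε - n * N))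
        + n * N * G (p ^ (2 * s + 1) * (p ^ (2 * (s + 1)) - p ^ (2 * s + 1)
          - ε - p ^ (s + 1) + n * r))
        + (M - n) * N * G (p ^ (2 * s + 1) * (p ^ (2 * (s + 1)) - p ^ (2 * s + 1)
          - ε + n * r)) := by
  have hP : p ^ (2 * s + 1) * p = Fintype.card F := by rw [hF]; ring
  have hN0 := exponent_ne_zero (Fact.out : p.Prime).one_lt hM hN
  have hc' : algebraMap (ZMod p) F c ≠ 0 := (map_ne_zero _).2 hc
  rw [← Equiv.sum_comp (Equiv.mulLeft₀ _ hc')]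
  simp only [Equiv.mulLeft₀_apply, hammingNorm_codeword_algebraMap hN0 hP hc, hε]
  rw [sum_tracePointCount hF hM hN hn fun x => G ((p ^ (2 * s + 1) : ℕ)
    * (Fintype.card F - ε - x)), hF]
  push_cast
  congr 4 <;> ring

theorem hasWeightRows_definingSet (hF : Fintype.card F = p ^ (2 * (s + 1)))
    (hM : M * r = p ^ (s + 1) + 1) (hN : N = (p ^ (s + 1) - 1) * r)
    (hn : rootTraceCount (ZMod p) F M u = n) (hε : (if u = 0 then 1 else 0) = ε) :
    HasWeightRows p (definingSet p F N u) (weightRows p s M r N n ε) := by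
  intro G
  have hP : p ^ (2 * s + 1) * p = Fintype.card F := by rw [hF]; ring
  have hN0 := exponent_ne_zero (Fact.out : p.Prime).one_lt hM hN
  have hout (γ : F) (hγ : γ ∉ Set.range (algebraMap (ZMod p) F)) :
      ∑ δ, G (hammingNorm (codeword p (definingSet p F N u) (γ, δ))) = p ^ (2 * (s + 1))
        * G (p ^ (2 * s + 1) * (p ^ (2 * (s + 1)) - p ^ (2 * s + 1))) := by
    simp only [hammingNorm_codeword_of_notMem_range hN0 hP hγ, sum_const, card_univ, nsmul_eq_mul,
      hF]
    push_cast
    rfl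
  have hzero : ∑ δ, G (hammingNorm (codeword p (definingSet p F N u) (0, δ)))
      = G 0 + (p ^ (2 * (s + 1)) - 1)
        * G (p ^ (2 * s + 1) * (p ^ (2 * (s + 1)) - p ^ (2 * s + 1))) := by
    rw [sum_eq_add_of_forall_ne (a := 0) fun δ hδ =>
      congrArg G (hammingNorm_codeword_zero_left hN0 hP hδ), ← Prod.zero_eq_mk, map_zero,
      hammingNorm_zero, hF]
    push_cast
    rfl
  rw [Fintype.sum_prod_type, sum_eq_sum_algebraMap_add hout, sum_eq_add_of_forall_ne (a := 0)
    fun c hc => sum_hammingNorm_algebraMap hF hM hN hn hε hc G, map_zero, hzero, hF, ZMod.card]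
  simp only [weightRows, List.map_cons, List.map_nil, List.sum_cons, List.sum_nil]
  push_cast
  ring

end Enumerator

section WeightRows

variable {p s M r N n ε : ℕ}

theorem fst_pos_of_mem_weightRows (hp : 3 ≤ p) (hM : M * r = p ^ (s + 1) + 1)
    (hN : N = (p ^ (s + 1) - 1) * r) (hn : n + ε ≤ M) (hε : ε ≤ 1) :
    ∀ a ∈ weightRows p s M r N n ε, 0 < a.1 := by
  have hp' : (3 : ℝ) ≤ p := by exact_mod_cast hp
  have hB : 1 ≤ (p : ℝ) ^ s := one_le_pow₀ (by linarith)
  have hQ : 3 * (p : ℝ) ^ s ≤ p ^ (s + 1) := by rw [pow_succ']; gcongr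
  have hP : (p : ℝ) ^ (2 * s + 1) = p ^ (s + 1) * p ^ s := by ring
  have hq : (p : ℝ) ^ (2 * (s + 1)) = p ^ (s + 1) * p ^ (s + 1) := by ring
  have hε' : (ε : ℝ) ≤ 1 := by exact_mod_cast hε
  have hnN : (n : ℝ) * N < p ^ (2 * (s + 1)) - ε := by
    have hNM : (N : ℝ) * M = p ^ (2 * (s + 1)) - 1 := by
      rw [← Nat.cast_mul, mul_eq_pow_sub_one hM hN, Nat.cast_pred (pow_pos (by lia) _),
        Nat.cast_pow]
    have hN1 : (1 : ℝ) ≤ N := by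
      exact_mod_cast Nat.one_le_iff_ne_zero.2 (exponent_ne_zero (by lia) hM hN)
    have hn' : (n : ℝ) + ε ≤ M := by exact_mod_cast hn
    nlinarith [Nat.cast_nonneg (α := ℝ) ε]
  have hgap : 0 < (p : ℝ) ^ (2 * (s + 1)) - p ^ (2 * s + 1) - ε - p ^ (s + 1) := by
    rw [hP, hq]
    nlinarith
  have hnr : 0 ≤ (n : ℝ) * r := by positivity
  have hpos : 0 < (p : ℝ) ^ (2 * s + 1) := by positivity
  simp only [weightRows, List.forall_mem_cons, List.not_mem_nil, false_imp_iff, implies_true,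
    and_true]
  refine ⟨?_, ?_, ?_, ?_⟩ <;> refine mul_pos hpos ?_ <;> linarith [Nat.cast_nonneg (α := ℝ) ε]

theorem snd_pos_of_mem_weightRows (hp : 1 < p) (hN0 : N ≠ 0) (hn : 0 < n) (hnM : n < M) :
    ∀ a ∈ weightRows p s M r N n ε, 0 < a.2 := by
  have hp' : (1 : ℝ) < p := by exact_mod_cast hp
  have hn' : (0 : ℝ) < n := by exact_mod_cast hn
  have hnM' : (n : ℝ) < M := by exact_mod_cast hnM
  have hN' : (0 : ℝ) < N := by exact_mod_cast Nat.pos_of_ne_zero hN0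
  have hq : (p : ℝ) ≤ p ^ (2 * (s + 1)) := le_self_pow₀ hp'.le (by lia)
  simp only [weightRows, List.forall_mem_cons, List.not_mem_nil, false_imp_iff, implies_true,
    and_true]
  refine ⟨by linarith, mul_pos (sub_pos.2 hp') (mul_pos hn' hN'),
    mul_pos (by linarith) (mul_pos (by linarith) hN'), ?_⟩
  exact add_pos_of_pos_of_nonneg (by linarith) (mul_nonneg (by linarith) (by linarith))

theorem add_mul_ne_mul_add {B Q X : ℕ} (hB : 0 < B) (hQ : 3 * B ≤ Q) (hε : ε ≤ 1) (hX : X ≠ ε) :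
    X + Q * B ≠ X * Q + ε := by
  intro h
  rcases lt_trichotomy X B with hlt | rfl | hlt
  · nlinarith
  · exact hX (by nlinarith)
  · nlinarith

theorem fst_head_mem_tail_weightRows_iff (hp : 3 ≤ p) (hN : N = (p ^ (s + 1) - 1) * r)
    (hε : ε ≤ 1) (h₀₃ : n * r ≠ ε) :
    (p : ℝ) ^ (2 * s + 1) * (p ^ (2 * (s + 1)) - ε - n * N)
        ∈ (weightRows p s M r N n ε).tail.map Prod.fst
      ↔ n * r = p ^ s ∨ n * r = p ^ s + 1 := by
  have hQ : 3 * p ^ s ≤ p ^ (s + 1) := by rw [pow_succ']; gcongr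
  have hQ0 : (p : ℝ) ^ (s + 1) ≠ 0 := by positivity
  have hP : (p : ℝ) ^ (2 * s + 1) = p ^ (s + 1) * p ^ s := by ring
  have hpos : (p : ℝ) ^ (2 * s + 1) ≠ 0 := by positivity
  have hnN : (n : ℝ) * N = n * r * (p ^ (s + 1) - 1) := by
    rw [hN, Nat.cast_mul, Nat.cast_sub (Nat.one_le_pow _ _ (by lia))]
    push_cast
    ring
  have h₀₁ := add_mul_ne_mul_add (pow_pos (by lia) s) hQ hε h₀₃
  rify at h₀₁ ⊢
  simp only [weightRows, List.tail_cons, List.map_cons, List.map_nil, List.mem_cons,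
    List.not_mem_nil, or_false, mul_right_inj' hpos, hnN]
  constructor
  · rintro (h | h | h)
    · exact Or.inr (mul_left_cancel₀ hQ0 (by linear_combination hP - h))
    · exact Or.inl (mul_left_cancel₀ hQ0 (by linear_combination hP - h))
    · exact absurd (by linear_combination h - hP) h₀₁
  · rintro (h | h)
    · exact Or.inr (Or.inl (by linear_combination hP - (p : ℝ) ^ (s + 1) * h))
    · exact Or.inl (by linear_combination hP - (p : ℝ) ^ (s + 1) * h)

theorem nodup_map_fst_tail_weightRows (hp : 0 < p) (h₀₃ : n * r ≠ ε)
    (h₀₂ : n * r ≠ p ^ (s + 1) + ε) : ((weightRows p s M r N n ε).tail.map Prod.fst).Nodup := by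
  have hQ0 : (p : ℝ) ^ (s + 1) ≠ 0 := by positivity
  have hpos : (p : ℝ) ^ (2 * s + 1) ≠ 0 := by positivity
  rify at h₀₂ h₀₃
  simp only [weightRows, List.tail_cons, List.map_cons, List.map_nil, List.nodup_cons,
    List.mem_cons, List.not_mem_nil, or_false, not_or, mul_right_inj' hpos, List.nodup_nil,
    and_true, not_false_eq_true]
  exact ⟨⟨fun h => hQ0 (by linear_combination -h), fun h => h₀₂ (by linear_combination h)⟩,
    fun h => h₀₃ (by linear_combination h)⟩

variable [Fact p.Prime] {F : Type*} [Field F] [Fintype F] [Algebra (ZMod p) F] {D : Finset (F × F)}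

theorem HasWeightRows.isWeightCode_weightRows (h : HasWeightRows p D (weightRows p s M r N n ε))
    (hp : 3 ≤ p) (hM : M * r = p ^ (s + 1) + 1) (hN : N = (p ^ (s + 1) - 1) * r)
    (hn : 0 < n) (hnM : n < M) (hε : ε ≤ 1) (h₀₃ : n * r ≠ ε) (h₀₂ : n * r ≠ p ^ (s + 1) + ε) :
    IsWeightCode (if n * r = p ^ s ∨ n * r = p ^ s + 1 then 3 else 4) (code p D) := by
  have hpos (a) (ha : a ∈ weightRows p s M r N n ε) : 0 < a.1 ∧ 0 < a.2 :=
    ⟨fst_pos_of_mem_weightRows hp hM hN (by lia) hε a ha,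
      snd_pos_of_mem_weightRows (by lia) (exponent_ne_zero (by lia) hM hN) hn hnM a ha⟩
  have htail := List.toFinset_card_of_nodup
    (nodup_map_fst_tail_weightRows (M := M) (N := N) (by lia) h₀₃ h₀₂)
  have hcons : ((weightRows p s M r N n ε).map Prod.fst).toFinset
      = insert _ ((weightRows p s M r N n ε).tail.map Prod.fst).toFinset := List.toFinset_cons
  convert h.isWeightCode hpos
  rw [hcons, card_insert_eq_ite, htail]
  simp only [List.mem_toFinset, fst_head_mem_tail_weightRows_iff hp hN hε h₀₃]
  rfl

theorem HasWeightRows.isWeightCode_three_of_eq_zero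
    (h : HasWeightRows p D (weightRows p s M r N 0 1)) (hp : 3 ≤ p)
    (hM : M * r = p ^ (s + 1) + 1) (hN : N = (p ^ (s + 1) - 1) * r) :
    IsWeightCode 3 (code p D) := by
  have hM0 : 0 < M := Nat.pos_of_ne_zero (by rintro rfl; lia)
  have hp1 : (1 : ℝ) < p := by exact_mod_cast (by lia : 1 < p)
  have hq : (p : ℝ) ≤ p ^ (2 * (s + 1)) := le_self_pow₀ hp1.le (by lia)
  have hP : 1 < (p : ℝ) ^ (2 * s + 1) := one_lt_pow₀ hp1 (by lia)
  have hrows : HasWeightRows p D ((weightRows p s M r N 0 1).eraseIdx 1) := fun G => by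
    rw [h G]
    simp [weightRows]
  have hfst : ∀ a ∈ (weightRows p s M r N 0 1).eraseIdx 1, 0 < a.1 := fun a ha =>
    fst_pos_of_mem_weightRows hp hM hN (by lia) le_rfl a (List.mem_of_mem_eraseIdx ha)
  have hsnd : ∀ a ∈ (weightRows p s M r N 0 1).eraseIdx 1, 0 < a.2 := by
    simp only [weightRows, List.eraseIdx, List.forall_mem_cons, List.not_mem_nil, false_imp_iff,
      implies_true, and_true, Nat.cast_zero, sub_zero]
    have hp1' := sub_pos.2 hp1
    have hN0 : (0 : ℝ) < N :=
      Nat.cast_pos.2 (Nat.pos_of_ne_zero (exponent_ne_zero (by lia) hM hN))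
    exact ⟨hp1', by positivity, by nlinarith⟩
  have hnodup : (((weightRows p s M r N 0 1).eraseIdx 1).map Prod.fst).Nodup := by
    simp only [weightRows, List.eraseIdx, List.map_cons, List.map_nil, List.nodup_cons,
      List.mem_cons, List.not_mem_nil, or_false, not_or, List.nodup_nil, and_true,
      not_false_eq_true, mul_right_inj' (zero_lt_one.trans hP).ne', Nat.cast_zero, zero_mul,
      Nat.cast_one, sub_zero, add_zero]
    exact ⟨⟨by linarith, by linarith⟩, by linarith⟩
  convert hrows.isWeightCode fun a ha => ⟨hfst a ha, hsnd a ha⟩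
  rw [List.toFinset_card_of_nodup hnodup]
  rfl

theorem HasWeightRows.hasWeightRows_two (h : HasWeightRows p D (weightRows p s M r N 0 0))
    (hM : M * r = p ^ (s + 1) + 1) (hN : N = (p ^ (s + 1) - 1) * r) :
    HasWeightRows p D [((p : ℝ) ^ (2 * (2 * s + 1) + 1), p - 1),
      ((p : ℝ) ^ (2 * (2 * s + 1)) * (p - 1), (p ^ (2 * (s + 1))) ^ 2 - p)] := by
  intro G
  have hNM : (N : ℝ) * M = p ^ (2 * (s + 1)) - 1 := by
    rw [← Nat.cast_mul, mul_eq_pow_sub_one hM hN,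
      Nat.cast_pred (pow_pos (Fact.out : p.Prime).pos _), Nat.cast_pow]
  have hmax : (p : ℝ) ^ (2 * s + 1) * p ^ (2 * (s + 1)) = p ^ (2 * (2 * s + 1) + 1) := by ring
  have hmean : (p : ℝ) ^ (2 * s + 1) * (p ^ (2 * (s + 1)) - p ^ (2 * s + 1))
      = p ^ (2 * (2 * s + 1)) * (p - 1) := by ring
  rw [h G]
  simp only [weightRows, List.map_cons, List.map_nil, List.sum_cons, List.sum_nil, Nat.cast_zero,
    zero_mul, sub_zero, add_zero, hmax, hmean]
  linear_combination (p - 1) * G (p ^ (2 * (2 * s + 1)) * (p - 1)) * hNM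

end WeightRows

section Arithmetic

variable {p ℓ j s r d m n : ℕ}

theorem coprime_pow_of_dvd_pow_add_one (h : d ∣ p ^ (s + 1) + 1) (i : ℕ) :
    Nat.Coprime (p ^ i) d := by
  have hself : Nat.Coprime (p ^ (s + 1)) (p ^ (s + 1) + 1) := by simp
  exact (((Nat.coprime_pow_left_iff s.succ_pos p _).1 hself).coprime_dvd_right h).pow_left i

theorem dvd_two_of_dvd_pow_add_one_of_dvd_pow_succ_add_one (hs : d ∣ p ^ s + 1)
    (hs1 : d ∣ p ^ (s + 1) + 1) : d ∣ 2 := by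
  zify at hs hs1 ⊢
  have hp : (d : ℤ) ∣ p - 1 := by
    have hsub := (hs.mul_left (p : ℤ)).sub hs1
    rwa [show (p : ℤ) * (p ^ s + 1) - (p ^ (s + 1) + 1) = p - 1 by ring] at hsub
  have hsub := hs.sub (hp.trans (sub_one_dvd_pow_sub_one (p : ℤ) s))
  rwa [show (p : ℤ) ^ s + 1 - (p ^ s - 1) = 2 by ring] at hsub

theorem natCast_pow_eq_one_iff (hp : 0 < p) {i : ℕ} : (p : ZMod m) ^ i = 1 ↔ m ∣ p ^ i - 1 := by
  rw [← Nat.modEq_iff_dvd' (Nat.one_le_pow _ _ hp), ← ZMod.natCast_eq_natCast_iff, eq_comm]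
  simp

theorem orderOf_natCast_two_mul (hp : Odd p) (hm : Odd m) :
    orderOf (p : ZMod (2 * m)) = orderOf (p : ZMod m) := by
  refine orderOf_eq_orderOf_iff.2 fun i => ?_
  rw [natCast_pow_eq_one_iff hp.pos, natCast_pow_eq_one_iff hp.pos]
  exact ⟨(dvd_mul_left m 2).trans, hm.coprime_two_left.mul_dvd_of_dvd_of_dvd
    (hp.pow.tsub_odd odd_one).two_dvd⟩

theorem prime_pow_dvd_add_one_of_dvd_mul (hℓ : ℓ.Prime) (hℓ2 : ℓ ≠ 2) {x : ℕ}
    (h : ℓ ^ n ∣ (x + 1) * (x - 1)) (hx : ¬ ℓ ^ n ∣ x - 1) : ℓ ^ n ∣ x + 1 := by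
  by_cases hplus : ℓ ∣ x + 1
  · have hminus : ¬ ℓ ∣ x - 1 := fun hminus => by
      have hx1 : x - 1 ≠ 0 := fun h0 => hx (h0 ▸ dvd_zero _)
      have htwo := Nat.dvd_sub hplus hminus
      rw [show x + 1 - (x - 1) = 2 by lia] at htwo
      exact hℓ2 ((Nat.prime_dvd_prime_iff_eq hℓ Nat.prime_two).1 htwo)
    exact ((hℓ.coprime_iff_not_dvd.2 hminus).pow_left n).dvd_of_dvd_mul_right h
  · exact absurd (((hℓ.coprime_iff_not_dvd.2 hplus).pow_left n).dvd_of_dvd_mul_left h) hx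

theorem prime_pow_dvd_pow_add_one_of_orderOf (hp : 0 < p) (hℓ : ℓ.Prime) (hℓ2 : ℓ ≠ 2)
    (h : orderOf (p : ZMod (ℓ ^ n)) = 2 * (s + 1)) : ℓ ^ n ∣ p ^ (s + 1) + 1 := by
  refine prime_pow_dvd_add_one_of_dvd_mul hℓ hℓ2 ?_ fun hdvd => ?_
  · rw [← Nat.sq_sub_sq, one_pow, ← pow_mul, mul_comm, ← natCast_pow_eq_one_iff hp, ← h,
      pow_orderOf_eq_one]
  · have hle := Nat.le_of_dvd s.succ_pos (orderOf_dvd_of_pow_eq_one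
      ((natCast_pow_eq_one_iff hp).2 hdvd))
    lia

theorem eq_one_of_pow_dvd_pow_add_one {i : ℕ} (h : p ^ i ∣ p ^ (s + 1) + 1) : p ^ i = 1 :=
  (Nat.coprime_self _).1 (coprime_pow_of_dvd_pow_add_one h i)

theorem eq_three_of_pow_mul_eq_two (hℓ : ℓ.Prime) (hℓ2 : ℓ ≠ 2) (h : ℓ ^ j * (ℓ - 1) = 2) :
    ℓ = 3 ∧ j = 0 := by
  have hle := Nat.le_of_dvd two_pos (Dvd.intro_left _ h)
  obtain rfl : ℓ = 3 := by have := hℓ.two_le; lia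
  refine ⟨rfl, ?_⟩
  by_contra hj
  have := Nat.le_self_pow hj 3
  lia

end Arithmetic

/-- The arithmetic setting of the theorem, with `k = j + 1`: the prime `p` is a primitive root
modulo `ℓ ^ (j + 1)`, the exponent `φ(ℓ ^ (j + 1))` is `2 * (s + 1)`, so that `√q = p ^ (s + 1)`,
and `r` stands for `(√q + 1) / (2 * ℓ ^ (j + 1))`. -/
structure IsPrimitiveDatum (p ℓ j s r : ℕ) : Prop where
  prime_base : p.Prime
  base_ne_two : p ≠ 2
  prime : ℓ.Prime
  ne_two : ℓ ≠ 2
  orderOf_eq : orderOf (p : ZMod (ℓ ^ (j + 1))) = (ℓ ^ (j + 1)).totient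
  totient_eq : (ℓ ^ (j + 1)).totient = 2 * (s + 1)
  mul_eq : 2 * ℓ ^ (j + 1) * r = p ^ (s + 1) + 1

theorem exists_isPrimitiveDatum {p ℓ j : ℕ} (hp : p.Prime) (hp2 : p ≠ 2) (hℓ : ℓ.Prime)
    (hℓ2 : ℓ ≠ 2) (h : orderOf (p : ZMod (2 * ℓ ^ (j + 1))) = (2 * ℓ ^ (j + 1)).totient) :
    ∃ s r, IsPrimitiveDatum p ℓ j s r := by
  have hpodd := hp.odd_of_ne_two hp2
  have hodd : Odd (ℓ ^ (j + 1)) := (hℓ.odd_of_ne_two hℓ2).pow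
  rw [orderOf_natCast_two_mul hpodd hodd, Nat.totient_mul hodd.coprime_two_left,
    Nat.totient_two, one_mul] at h
  have hone : ℓ ^ (j + 1) ≠ 1 := Nat.one_lt_pow j.succ_ne_zero hℓ.one_lt |>.ne'
  have hpow2 : 2 < ℓ ^ (j + 1) := by
    have := Nat.odd_iff.1 hodd
    have := hodd.pos
    lia
  obtain ⟨t, ht⟩ := Nat.totient_even hpow2
  have htpos := Nat.totient_pos.2 hodd.pos
  obtain ⟨s, rfl⟩ := Nat.exists_eq_add_of_lt (show 0 < t by lia)
  have hs : (ℓ ^ (j + 1)).totient = 2 * (s + 1) := by lia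
  obtain ⟨r, hr⟩ := hodd.coprime_two_left.mul_dvd_of_dvd_of_dvd
    hpodd.pow.add_one.two_dvd (prime_pow_dvd_pow_add_one_of_orderOf hp.pos hℓ hℓ2 (h.trans hs))
  exact ⟨s, r, hp, hp2, hℓ, hℓ2, h, hs, hr.symm⟩

namespace IsPrimitiveDatum

variable {p ℓ j s r n : ℕ}

theorem three_le (h : IsPrimitiveDatum p ℓ j s r) : 3 ≤ ℓ := by
  have := h.prime.two_le
  have := h.ne_two
  lia

theorem three_le_base (h : IsPrimitiveDatum p ℓ j s r) : 3 ≤ p := by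
  have := h.prime_base.two_le
  have := h.base_ne_two
  lia

theorem odd (h : IsPrimitiveDatum p ℓ j s r) : Odd ℓ := h.prime.odd_of_ne_two h.ne_two

theorem odd_base (h : IsPrimitiveDatum p ℓ j s r) : Odd p :=
  h.prime_base.odd_of_ne_two h.base_ne_two

theorem pow_mul_pred (h : IsPrimitiveDatum p ℓ j s r) : ℓ ^ j * (ℓ - 1) = 2 * (s + 1) := by
  rw [← h.totient_eq, Nat.totient_prime_pow_succ h.prime]

theorem pred_le (h : IsPrimitiveDatum p ℓ j s r) : ℓ - 1 ≤ 2 * (s + 1) :=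
  h.pow_mul_pred ▸ Nat.le_mul_of_pos_left _ (pow_pos h.prime.pos j)

theorem pos (h : IsPrimitiveDatum p ℓ j s r) : 0 < r :=
  Nat.pos_of_ne_zero fun h0 => by simpa [h0] using h.mul_eq

theorem base_ne (h : IsPrimitiveDatum p ℓ j s r) : p ≠ ℓ := by
  rintro rfl
  have hdvd : p ^ 1 ∣ p ^ (s + 1) + 1 :=
    ((pow_dvd_pow p (by lia)).trans (dvd_mul_left _ 2)).trans (Dvd.intro r h.mul_eq)
  have := eq_one_of_pow_dvd_pow_add_one hdvd
  exact h.prime.one_lt.ne' (by rwa [pow_one] at this)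

theorem dvd (h : IsPrimitiveDatum p ℓ j s r) : r ∣ p ^ (s + 1) + 1 := Dvd.intro_left _ h.mul_eq

theorem mul_dvd (h : IsPrimitiveDatum p ℓ j s r) : ℓ * r ∣ p ^ (s + 1) + 1 :=
  Dvd.intro (2 * ℓ ^ j) (by rw [← h.mul_eq]; ring)

theorem mul_lt_pow (h : IsPrimitiveDatum p ℓ j s r) (hn : n ≤ ℓ) : n * r < p ^ (s + 1) := by
  have hle : n * r ≤ ℓ ^ (j + 1) * r :=
    Nat.mul_le_mul_right r (hn.trans (Nat.le_self_pow j.succ_ne_zero ℓ))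
  have hlt := Nat.one_lt_pow s.succ_ne_zero h.prime_base.one_lt
  have := h.mul_eq
  rw [mul_assoc] at this
  lia

theorem eq_three (h : IsPrimitiveDatum p ℓ j s r) (hs : s = 0) : ℓ = 3 ∧ j = 0 :=
  eq_three_of_pow_mul_eq_two h.prime h.ne_two (by rw [h.pow_mul_pred, hs])

theorem ne_pow_of_even (h : IsPrimitiveDatum p ℓ j s r) (hn : Even n) : n * r ≠ p ^ s := fun heq =>
  Nat.not_even_iff_odd.2 h.odd_base.pow (heq ▸ hn.mul_right r)

theorem eq_pow_or_eq_pow_add_one_iff (h : IsPrimitiveDatum p ℓ j s r) :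
    r = p ^ s ∨ r = p ^ s + 1 ↔ ℓ = 3 ∧ j = 0 ∧ (p = 5 ∨ p = 11) := by
  have hmul := h.mul_eq
  have hpred := h.pow_mul_pred
  refine ⟨fun hr => ?_, ?_⟩
  · have hpow : p ^ s = 1 := by
      rcases hr with rfl | hr
      · exact eq_one_of_pow_dvd_pow_add_one h.dvd
      · have := Nat.le_of_dvd two_pos
          (dvd_two_of_dvd_pow_add_one_of_dvd_pow_succ_add_one (dvd_of_eq hr) h.dvd)
        have := pow_pos h.prime_base.pos s
        lia
    obtain rfl : s = 0 := (Nat.pow_eq_one.1 hpow).resolve_left h.prime_base.one_lt.ne'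
    obtain ⟨rfl, rfl⟩ := h.eq_three rfl
    exact ⟨rfl, rfl, by lia⟩
  · rintro ⟨rfl, rfl, rfl | rfl⟩ <;> obtain rfl : s = 0 := by lia
    all_goals lia

theorem mul_ne_pow (h : IsPrimitiveDatum p ℓ j s r) : ℓ * r ≠ p ^ s := fun heq =>
  h.prime.one_lt.ne' (mul_eq_one.1
    (heq.trans (eq_one_of_pow_dvd_pow_add_one (heq ▸ h.mul_dvd)))).1

theorem mul_ne_pow_add_one (h : IsPrimitiveDatum p ℓ j s r) : ℓ * r ≠ p ^ s + 1 := fun heq =>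
  h.ne_two ((Nat.prime_dvd_prime_iff_eq h.prime Nat.prime_two).1 ((dvd_mul_right ℓ r).trans
    (dvd_two_of_dvd_pow_add_one_of_dvd_pow_succ_add_one (dvd_of_eq heq) h.mul_dvd)))

theorem lt_three_of_pred_mul_eq (h : IsPrimitiveDatum p ℓ j s r) (heq : (ℓ - 1) * r = p ^ s + 1) :
    s < 3 := by
  have hr := Nat.le_of_dvd two_pos
    (dvd_two_of_dvd_pow_add_one_of_dvd_pow_succ_add_one (Dvd.intro_left _ heq) h.dvd)
  have hbound : 3 ^ s + 1 ≤ 4 * (s + 1) := calc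
    3 ^ s + 1 ≤ p ^ s + 1 := by gcongr; exact h.three_le_base
    _ = (ℓ - 1) * r := heq.symm
    _ ≤ 2 * (s + 1) * 2 := Nat.mul_le_mul h.pred_le hr
    _ = 4 * (s + 1) := by ring
  by_contra! hs
  have hlt : ∀ t : ℕ, 4 * (t + 3 + 1) < 3 ^ (t + 3) + 1 := fun t => by
    induction t with
    | zero => norm_num
    | succ t ih => rw [show t + 1 + 3 = t + 3 + 1 by ring, pow_succ]; lia
  obtain ⟨t, rfl⟩ := Nat.exists_eq_add_of_le' hs
  exact absurd hbound (hlt t).not_ge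

theorem pred_mul_eq_pow_add_one_iff (h : IsPrimitiveDatum p ℓ j s r) (hℓ : ¬ p ∣ ℓ - 2) :
    (ℓ - 1) * r = p ^ s + 1 ↔ ℓ = 3 ∧ j = 0 ∧ p = 5 := by
  have hmul := h.mul_eq
  have hpred := h.pow_mul_pred
  refine ⟨fun heq => ?_, ?_⟩
  · have hr : r ∣ 2 :=
      dvd_two_of_dvd_pow_add_one_of_dvd_pow_succ_add_one (Dvd.intro_left _ heq) h.dvd
    have hr2 := Nat.le_of_dvd two_pos hr
    have hpos := h.pos
    have hle := h.pred_le
    have h3 := h.three_le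
    have hp3 := h.three_le_base
    have hne := h.base_ne
    obtain ⟨t, rfl⟩ := h.odd
    have hs := h.lt_three_of_pred_mul_eq heq
    interval_cases s
    · obtain ⟨hℓ3, rfl⟩ := h.eq_three rfl
      obtain rfl : t = 1 := by lia
      exact ⟨rfl, rfl, by lia⟩
    · have ht1 : 1 ≤ t := by lia
      have ht2 : t ≤ 2 := by lia
      rw [pow_succ] at hmul
      interval_cases t
      · interval_cases r <;> lia
      · interval_cases r
        · exact absurd ⟨1, by lia⟩ hℓ
        · obtain rfl : p = 7 := by lia
          lia
    · have hp : p < 4 := by nlinarith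
      interval_cases p
      interval_cases r <;> lia
  · rintro ⟨rfl, rfl, rfl⟩
    obtain rfl : s = 0 := by lia
    lia

theorem mul_ne_pow_add_one_of_add_two_mul (h : IsPrimitiveDatum p ℓ j s r) (hj : j ≠ 0)
    (hn : n + 2 * ℓ = 2 * ℓ ^ (j + 1)) : n * r ≠ p ^ s + 1 := fun heq => by
  have hmul := h.mul_eq
  rw [← hn, add_mul, heq, pow_succ] at hmul
  have hdvd : p ^ s ∣ 2 * ℓ * r := (Nat.dvd_add_right (dvd_refl _)).1 ⟨p, by lia⟩
  have hdvd' : 2 * ℓ * r ∣ p ^ (s + 1) + 1 := Dvd.intro (ℓ ^ j) (by rw [← h.mul_eq]; ring)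
  have hs := (Nat.pow_eq_one.1 (eq_one_of_pow_dvd_pow_add_one (hdvd.trans hdvd'))).resolve_left
    h.prime_base.one_lt.ne'
  exact hj (h.eq_three hs).2

theorem mul_ne_pow_add_one_of_add_two_mul_pred (h : IsPrimitiveDatum p ℓ j s r) (hdvd : p ∣ ℓ - 1)
    (hn : n + 2 * (ℓ - 1) = 2 * ℓ ^ (j + 1)) : n * r ≠ p ^ s + 1 := fun heq => by
  have hmul := h.mul_eq
  rw [← hn, add_mul, heq, pow_succ] at hmul
  have hdvdr : p ^ s ∣ 2 * (ℓ - 1) * r := (Nat.dvd_add_right (dvd_refl _)).1 ⟨p, by lia⟩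
  obtain ⟨t, ht⟩ := h.odd.tsub_odd odd_one
  have hdvdt : p ^ s ∣ t := by
    have h4 : Nat.Coprime (p ^ s) 4 :=
      Nat.Coprime.pow_left s (Nat.Coprime.pow_right 2 (Nat.coprime_two_right.2 h.odd_base))
    refine h4.dvd_of_dvd_mul_left ?_
    convert (coprime_pow_of_dvd_pow_add_one h.dvd s).dvd_of_dvd_mul_right hdvdr using 1
    lia
  have hle := Nat.le_of_dvd (by have := h.three_le; lia) hdvdt
  have hpred := h.pred_le
  have hs : s = 0 := by
    by_contra hs
    obtain ⟨i, rfl⟩ := Nat.exists_eq_succ_of_ne_zero hs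
    have hi : i < p ^ i := Nat.lt_pow_self h.prime_base.one_lt
    have : 3 * p ^ i ≤ p ^ (i + 1) := by
      rw [pow_succ, mul_comm]
      gcongr
      exact h.three_le_base
    lia
  obtain ⟨rfl, rfl⟩ := h.eq_three hs
  exact h.base_ne_two ((Nat.prime_dvd_prime_iff_eq h.prime_base Nat.prime_two).1 hdvd)

end IsPrimitiveDatum

section RootCounts

variable {p : ℕ} [Fact p.Prime]

theorem ite_eq_add_ite_eq_neg (hp2 : p ≠ 2) {u : ZMod p} (hu : u ≠ 0) (a : ZMod p) (c : ℕ) :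
    ((if a = u then c else 0) + if a = -u then c else 0) = if u ^ 2 = a ^ 2 then c else 0 := by
  have hne : u ≠ -u := fun h => by
    have h2 : (2 : ZMod p) ≠ 0 := Ring.two_ne_zero (by rwa [ZMod.ringChar_zmod_n])
    exact (mul_ne_zero h2 hu) (by linear_combination h)
  have hsq : u ^ 2 = a ^ 2 ↔ a = u ∨ a = -u := eq_comm.trans sq_eq_sq_iff_eq_or_eq_neg
  by_cases h : a = u
  · simp [h, hne]
  · simp [h, hsq]

variable {F : Type*} [Field F] [Fintype F] [DecidableEq F] [Algebra (ZMod p) F]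
  {ℓ j s r : ℕ} {u : ZMod p}

namespace IsPrimitiveDatum

theorem natCast_ne_zero (h : IsPrimitiveDatum p ℓ j s r) : (ℓ : ZMod p) ≠ 0 := fun h0 =>
  h.base_ne ((Nat.prime_dvd_prime_iff_eq h.prime_base h.prime).1
    ((ZMod.natCast_eq_zero_iff ℓ p).1 h0))

theorem natCast_totient (h : IsPrimitiveDatum p ℓ j s r) :
    ((ℓ ^ (j + 1)).totient : ZMod p) = (ℓ : ZMod p) ^ j * (ℓ - 1) := by
  rw [Nat.totient_prime_pow_succ h.prime, Nat.cast_mul, Nat.cast_pow, Nat.cast_pred h.prime.pos]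

theorem rootTraceCount_pow (h : IsPrimitiveDatum p ℓ j s r)
    (hF : Fintype.card F = p ^ (2 * (s + 1))) (u : ZMod p) :
    rootTraceCount (ZMod p) F (ℓ ^ (j + 1)) u
      = (if ((ℓ ^ (j + 1)).totient : ZMod p) = u then 1 else 0)
        + (if -(ℓ : ZMod p) ^ j = u then ℓ - 1 else 0)
        + (if 0 = u then ℓ ^ (j + 1) - ℓ else 0) := by
  refine rootTraceCount_prime_pow h.prime (by rw [ZMod.card, h.orderOf_eq])
    (by rw [h.totient_eq, finrank_eq_of_card_eq hF]) ?_ u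
  rw [hF, ← natCast_pow_eq_one_iff h.prime_base.pos, ← h.totient_eq, ← h.orderOf_eq,
    pow_orderOf_eq_one]

theorem rootTraceCount_two_mul_pow (h : IsPrimitiveDatum p ℓ j s r) (u : ZMod p) :
    rootTraceCount (ZMod p) F (2 * ℓ ^ (j + 1)) u
      = rootTraceCount (ZMod p) F (ℓ ^ (j + 1)) u + rootTraceCount (ZMod p) F (ℓ ^ (j + 1)) (-u) :=
  rootTraceCount_two_mul_of_odd (by rw [ZMod.ringChar_zmod_n]; exact h.base_ne_two) h.odd.pow u

theorem rootTraceCount_zero (h : IsPrimitiveDatum p ℓ j s r)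
    (hF : Fintype.card F = p ^ (2 * (s + 1))) :
    rootTraceCount (ZMod p) F (2 * ℓ ^ (j + 1)) 0
      = 2 * ((if (ℓ : ZMod p) = 1 then 1 else 0) + (ℓ ^ (j + 1) - ℓ)) := by
  rw [h.rootTraceCount_two_mul_pow, neg_zero, h.rootTraceCount_pow hF, h.natCast_totient]
  simp [pow_ne_zero j h.natCast_ne_zero, sub_eq_zero, two_mul]

theorem rootTraceCount_of_ne_zero (h : IsPrimitiveDatum p ℓ j s r)
    (hF : Fintype.card F = p ^ (2 * (s + 1))) (hu : u ≠ 0) :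
    rootTraceCount (ZMod p) F (2 * ℓ ^ (j + 1)) u
      = (if u ^ 2 = ((ℓ ^ (j + 1)).totient : ZMod p) ^ 2 then 1 else 0)
        + if u ^ 2 = (ℓ : ZMod p) ^ (2 * j) then ℓ - 1 else 0 := by
  rw [h.rootTraceCount_two_mul_pow, h.rootTraceCount_pow hF, h.rootTraceCount_pow hF,
    ← ite_eq_add_ite_eq_neg h.base_ne_two hu, mul_comm 2 j, pow_mul, ← neg_sq ((ℓ : ZMod p) ^ j),
    ← ite_eq_add_ite_eq_neg h.base_ne_two hu, if_neg hu.symm, if_neg (neg_ne_zero.2 hu).symm]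
  ring

end IsPrimitiveDatum

end RootCounts

section Cases

variable {p ℓ j s r N n d : ℕ}

namespace IsPrimitiveDatum

theorem exponent_eq_of_eq_div (h : IsPrimitiveDatum p ℓ j s r)
    (hN : N = (p ^ (2 * (s + 1)) - 1) / (2 * ℓ ^ (j + 1))) : N = (p ^ (s + 1) - 1) * r := by
  rw [hN, ← mul_eq_pow_sub_one h.mul_eq rfl]
  exact Nat.mul_div_cancel _ (mul_pos two_pos (pow_pos h.prime.pos _))

theorem natCast_mul_eq (h : IsPrimitiveDatum p ℓ j s r) :
    2 * (ℓ : ℝ) ^ (j + 1) * r = p ^ (s + 1) + 1 := by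
  exact_mod_cast h.mul_eq

theorem natCast_mul_exponent_eq (h : IsPrimitiveDatum p ℓ j s r)
    (hN : N = (p ^ (s + 1) - 1) * r) :
    2 * (ℓ : ℝ) ^ (j + 1) * N = p ^ (2 * (s + 1)) - 1 := by
  rw [hN, Nat.cast_mul, Nat.cast_pred (pow_pos h.prime_base.pos _), Nat.cast_pow]
  linear_combination ((p : ℝ) ^ (s + 1) - 1) * h.natCast_mul_eq

theorem div_eq (h : IsPrimitiveDatum p ℓ j s r) {x y : ℝ} (hxy : 2 * (ℓ : ℝ) ^ (j + 1) * x = y) :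
    y / (ℓ : ℝ) ^ (j + 1) = 2 * x ∧ y / (2 * (ℓ : ℝ) ^ (j + 1)) = x ∧
      y / (ℓ : ℝ) ^ j = 2 * ℓ * x ∧ y / (2 * (ℓ : ℝ) ^ j) = ℓ * x := by
  have hℓ : (ℓ : ℝ) ≠ 0 := Nat.cast_ne_zero.2 h.prime.ne_zero
  subst hxy
  refine ⟨?_, ?_, ?_, ?_⟩ <;> field

end IsPrimitiveDatum

variable [Fact p.Prime] {F : Type*} [Field F] [Fintype F] [Algebra (ZMod p) F]

theorem HasWeightRows.hasWeightTable_of_add_eq {D : Finset (F × F)} {M : ℕ}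
    (h : HasWeightRows p D (weightRows p s M r N n 1)) (hp : 3 ≤ p)
    (hM : M * r = p ^ (s + 1) + 1) (hN : N = (p ^ (s + 1) - 1) * r)
    (hn : n + 2 * d = M) (hd : d ≠ 0) :
    HasWeightTable (code p D)
      [(0, 1),
        ((p : ℝ) ^ (2 * s + 1) * d * (2 * N), (p : ℝ) - 1),
        ((p : ℝ) ^ (2 * (2 * s + 1)) * (p - 1) + p ^ (2 * s + 1) * (p ^ (s + 1) - d * (2 * r)),
          (p - 1) * d * (2 * N)),
        ((p : ℝ) ^ (2 * (2 * s + 1)) * (p - 1) - p ^ (2 * s + 1) * d * (2 * r),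
          (p - 1) * (M - 2 * d) * N),
        ((p : ℝ) ^ (2 * (2 * s + 1)) * (p - 1),
          (p : ℝ) ^ (2 * (s + 1)) - 1 + (p ^ (2 * (s + 1)) - p) * p ^ (2 * (s + 1)))] := by
  have hn' : (n : ℝ) = M - 2 * d := by rw [← hn]; push_cast; ring
  have hM' : (M : ℝ) * r = p ^ (s + 1) + 1 := by exact_mod_cast hM
  have hN' : (N : ℝ) = (p ^ (s + 1) - 1) * r := by
    rw [hN, Nat.cast_mul, Nat.cast_pred (pow_pos (Fact.out : p.Prime).pos _), Nat.cast_pow]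
  have hswap := (h.hasWeightTable (fst_pos_of_mem_weightRows hp hM hN (by lia) le_rfl)).perm
    (((List.Perm.swap _ _ _).cons _).cons _)
  convert hswap using 1
  simp only [hn', hN', List.cons.injEq, Prod.mk.injEq, Nat.cast_one, and_true, true_and]
  refine ⟨?_, ⟨?_, ?_⟩, ⟨?_, ?_⟩, ?_⟩
  · linear_combination (p : ℝ) ^ (2 * s + 1) * (p ^ (s + 1) - 1) * hM'
  · linear_combination -(p : ℝ) ^ (2 * s + 1) * hM'
  · ring
  · linear_combination -(p : ℝ) ^ (2 * s + 1) * hM'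
  · ring
  · ring

theorem HasWeightRows.hasWeightTable_of_le {D : Finset (F × F)} {M : ℕ}
    (h : HasWeightRows p D (weightRows p s M r N n 0)) (hp : 3 ≤ p)
    (hM : M * r = p ^ (s + 1) + 1) (hN : N = (p ^ (s + 1) - 1) * r) (hn : n ≤ M) :
    HasWeightTable (code p D)
      [(0, 1),
        ((p : ℝ) ^ (2 * (2 * s + 1) + 1) - p ^ (2 * s + 1) * n * N, (p : ℝ) - 1),
        ((p : ℝ) ^ (2 * (2 * s + 1)) * (p - 1) - p ^ (2 * s + 1) * p ^ (s + 1)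
            + p ^ (2 * s + 1) * n * r,
          (p - 1) * n * N),
        ((p : ℝ) ^ (2 * (2 * s + 1)) * (p - 1) + p ^ (2 * s + 1) * n * r,
          (p - 1) * (M - n) * N),
        ((p : ℝ) ^ (2 * (2 * s + 1)) * (p - 1),
          (p : ℝ) ^ (2 * (s + 1)) - 1 + p ^ (2 * (s + 1)) * (p ^ (2 * (s + 1)) - p))] := by
  convert h.hasWeightTable (fst_pos_of_mem_weightRows hp hM hN hn zero_le_one) using 1
  simp only [weightRows, List.cons.injEq, Prod.mk.injEq, Nat.cast_zero, and_true, true_and]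
  refine ⟨?_, ⟨?_, ?_⟩, ⟨?_, ?_⟩, ?_, ?_⟩ <;> ring

variable [DecidableEq F] {u : ZMod p}

namespace IsPrimitiveDatum

theorem card_definingSet_add (h : IsPrimitiveDatum p ℓ j s r)
    (hF : Fintype.card F = p ^ (2 * (s + 1))) (hN : N = (p ^ (s + 1) - 1) * r) :
    #(definingSet p F N u) + (if u = 0 then 1 else 0) = p ^ (2 * (2 * s + 1) + 1) := by
  rw [TraceCode.card_definingSet_add (P := p ^ (2 * s + 1))
    (exponent_ne_zero h.prime_base.one_lt h.mul_eq hN)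
    (by rw [hF]; ring), hF]
  ring

theorem hasWeightRows (h : IsPrimitiveDatum p ℓ j s r)
    (hF : Fintype.card F = p ^ (2 * (s + 1))) (hN : N = (p ^ (s + 1) - 1) * r) :
    HasWeightRows p (definingSet p F N u) (weightRows p s (2 * ℓ ^ (j + 1)) r N
      (rootTraceCount (ZMod p) F (2 * ℓ ^ (j + 1)) u) (if u = 0 then 1 else 0)) :=
  hasWeightRows_definingSet hF h.mul_eq hN rfl rfl

theorem rootTraceCount_add_le (h : IsPrimitiveDatum p ℓ j s r)
    (hF : Fintype.card F = p ^ (2 * (s + 1))) :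
    rootTraceCount (ZMod p) F (2 * ℓ ^ (j + 1)) u + (if u = 0 then 1 else 0)
      ≤ 2 * ℓ ^ (j + 1) := by
  have hle : ℓ ≤ ℓ ^ (j + 1) := Nat.le_self_pow j.succ_ne_zero ℓ
  have h3 := h.three_le
  by_cases hu : u = 0
  · subst hu
    rw [h.rootTraceCount_zero hF]
    split_ifs <;> lia
  · rw [h.rootTraceCount_of_ne_zero hF hu]
    split_ifs <;> lia

theorem injective_codeword (h : IsPrimitiveDatum p ℓ j s r)
    (hF : Fintype.card F = p ^ (2 * (s + 1))) (hN : N = (p ^ (s + 1) - 1) * r) :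
    Function.Injective (codeword p (definingSet p F N u)) :=
  (h.hasWeightRows hF hN).injective_codeword (fst_pos_of_mem_weightRows h.three_le_base h.mul_eq hN
    (h.rootTraceCount_add_le hF) (by split_ifs <;> simp))

theorem isWeightCode_four_zero (h : IsPrimitiveDatum p ℓ j s r)
    (hF : Fintype.card F = p ^ (2 * (s + 1))) (hN : N = (p ^ (s + 1) - 1) * r)
    (hn : 0 < rootTraceCount (ZMod p) F (2 * ℓ ^ (j + 1)) 0)
    (hne : rootTraceCount (ZMod p) F (2 * ℓ ^ (j + 1)) 0 * r ≠ p ^ s + 1) :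
    IsWeightCode 4 (code p (definingSet p F N 0)) := by
  have heven : Even (rootTraceCount (ZMod p) F (2 * ℓ ^ (j + 1)) 0) :=
    h.rootTraceCount_zero hF ▸ even_two_mul _
  have hlt := h.rootTraceCount_add_le (u := 0) hF
  have hrows := h.hasWeightRows (u := 0) hF hN
  rw [if_pos rfl] at hlt hrows
  set n := rootTraceCount (ZMod p) F (2 * ℓ ^ (j + 1)) 0
  have hmul : n * r < p ^ (s + 1) + 1 := h.mul_eq ▸ Nat.mul_lt_mul_of_pos_right hlt h.pos
  have hcode := hrows.isWeightCode_weightRows h.three_le_base h.mul_eq hN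
    hn hlt le_rfl (fun h1 => Nat.not_even_one (h1 ▸ heven.mul_right r)) hmul.ne
  rwa [if_neg (not_or.2 ⟨h.ne_pow_of_even heven, hne⟩)] at hcode

theorem isWeightCode_of_ne_zero (h : IsPrimitiveDatum p ℓ j s r)
    (hF : Fintype.card F = p ^ (2 * (s + 1))) (hN : N = (p ^ (s + 1) - 1) * r) (hu : u ≠ 0)
    (hn : rootTraceCount (ZMod p) F (2 * ℓ ^ (j + 1)) u = n) (hn0 : 0 < n) (hnℓ : n ≤ ℓ) :
    IsWeightCode (if n * r = p ^ s ∨ n * r = p ^ s + 1 then 3 else 4)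
      (code p (definingSet p F N u)) := by
  have hle : ℓ ≤ ℓ ^ (j + 1) := Nat.le_self_pow j.succ_ne_zero ℓ
  have h3 := h.three_le
  have hrows := h.hasWeightRows (u := u) hF hN
  rw [hn, if_neg hu] at hrows
  exact hrows.isWeightCode_weightRows h.three_le_base h.mul_eq hN hn0
    (by lia) zero_le_one (mul_pos hn0 h.pos).ne' (h.mul_lt_pow hnℓ).ne

theorem hasWeightTable_of_ne_zero (h : IsPrimitiveDatum p ℓ j s r)
    (hF : Fintype.card F = p ^ (2 * (s + 1))) (hN : N = (p ^ (s + 1) - 1) * r) (hu : u ≠ 0)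
    (hn : rootTraceCount (ZMod p) F (2 * ℓ ^ (j + 1)) u = n) :
    HasWeightTable (code p (definingSet p F N u))
      [(0, 1),
        ((p : ℝ) ^ (2 * (2 * s + 1) + 1) - p ^ (2 * s + 1) * n * N, (p : ℝ) - 1),
        ((p : ℝ) ^ (2 * (2 * s + 1)) * (p - 1) - p ^ (2 * s + 1) * p ^ (s + 1)
            + p ^ (2 * s + 1) * n * r,
          (p - 1) * n * N),
        ((p : ℝ) ^ (2 * (2 * s + 1)) * (p - 1) + p ^ (2 * s + 1) * n * r,
          (p - 1) * (2 * (ℓ : ℝ) ^ (j + 1) - n) * N),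
        ((p : ℝ) ^ (2 * (2 * s + 1)) * (p - 1),
          (p : ℝ) ^ (2 * (s + 1)) - 1 + p ^ (2 * (s + 1)) * (p ^ (2 * (s + 1)) - p))] := by
  have hle := h.rootTraceCount_add_le (u := u) hF
  have hrows := h.hasWeightRows (u := u) hF hN
  rw [hn, if_neg hu] at hrows hle
  exact_mod_cast hrows.hasWeightTable_of_le h.three_le_base h.mul_eq hN hle

theorem hasWeightTable_zero_of_eq_one (h : IsPrimitiveDatum p ℓ j s r)
    (hF : Fintype.card F = p ^ (2 * (s + 1))) (hN : N = (p ^ (s + 1) - 1) * r)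
    (hℓ : (ℓ : ZMod p) = 1) :
    HasWeightTable (code p (definingSet p F N 0))
      [(0, 1),
        ((p : ℝ) ^ (2 * s + 1) * (ℓ - 1) * (2 * N), (p : ℝ) - 1),
        ((p : ℝ) ^ (2 * (2 * s + 1)) * (p - 1)
            + p ^ (2 * s + 1) * (p ^ (s + 1) - (ℓ - 1) * (2 * r)),
          (p - 1) * (ℓ - 1) * (2 * N)),
        ((p : ℝ) ^ (2 * (2 * s + 1)) * (p - 1) - p ^ (2 * s + 1) * (ℓ - 1) * (2 * r),
          (p - 1) * ((ℓ : ℝ) ^ (j + 1) - ℓ + 1) * (2 * N)),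
        ((p : ℝ) ^ (2 * (2 * s + 1)) * (p - 1),
          (p : ℝ) ^ (2 * (s + 1)) - 1 + (p ^ (2 * (s + 1)) - p) * p ^ (2 * (s + 1)))] ∧
      IsWeightCode 4 (code p (definingSet p F N 0)) := by
  have hle : ℓ ≤ ℓ ^ (j + 1) := Nat.le_self_pow j.succ_ne_zero ℓ
  have h3 := h.three_le
  have hn : rootTraceCount (ZMod p) F (2 * ℓ ^ (j + 1)) 0 + 2 * (ℓ - 1) = 2 * ℓ ^ (j + 1) := by
    rw [h.rootTraceCount_zero hF, if_pos hℓ]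
    lia
  have hdvd : p ∣ ℓ - 1 := by
    rwa [← ZMod.natCast_eq_zero_iff, Nat.cast_pred h.prime.pos, sub_eq_zero]
  have hrows := h.hasWeightRows (u := 0) hF hN
  rw [if_pos rfl] at hrows
  refine ⟨?_, h.isWeightCode_four_zero hF hN (by lia)
    (h.mul_ne_pow_add_one_of_add_two_mul_pred hdvd hn)⟩
  convert hrows.hasWeightTable_of_add_eq h.three_le_base h.mul_eq hN hn
    (by lia) using 1
  push_cast [Nat.cast_pred h.prime.pos]
  ring_nf

theorem hasWeightTable_zero_of_ne_one (h : IsPrimitiveDatum p ℓ j s r)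
    (hF : Fintype.card F = p ^ (2 * (s + 1))) (hN : N = (p ^ (s + 1) - 1) * r)
    (hℓ : (ℓ : ZMod p) ≠ 1) :
    HasWeightTable (code p (definingSet p F N 0))
      [(0, 1),
        ((p : ℝ) ^ (2 * s + 1) * (2 * ℓ * N), (p : ℝ) - 1),
        ((p : ℝ) ^ (2 * (2 * s + 1)) * (p - 1) + p ^ (2 * s + 1) * (p ^ (s + 1) - 2 * ℓ * r),
          (p - 1) * (2 * ℓ * N)),
        ((p : ℝ) ^ (2 * (2 * s + 1)) * (p - 1) - p ^ (2 * s + 1) * (2 * ℓ * r),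
          (p - 1) * ((ℓ : ℝ) ^ j - 1) * (2 * ℓ * N)),
        ((p : ℝ) ^ (2 * (2 * s + 1)) * (p - 1),
          (p : ℝ) ^ (2 * (s + 1)) - 1 + (p ^ (2 * (s + 1)) - p) * p ^ (2 * (s + 1)))] ∧
      (j + 1 ≠ 1 → IsWeightCode 4 (code p (definingSet p F N 0))) ∧
      (j + 1 = 1 → IsWeightCode 3 (code p (definingSet p F N 0))) := by
  have hle : ℓ ≤ ℓ ^ (j + 1) := Nat.le_self_pow j.succ_ne_zero ℓ
  have hn : rootTraceCount (ZMod p) F (2 * ℓ ^ (j + 1)) 0 + 2 * ℓ = 2 * ℓ ^ (j + 1) := by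
    rw [h.rootTraceCount_zero hF, if_neg hℓ]
    lia
  have hrows := h.hasWeightRows (u := 0) hF hN
  rw [if_pos rfl] at hrows
  refine ⟨?_, fun hj => ?_, fun hj => ?_⟩
  · convert hrows.hasWeightTable_of_add_eq h.three_le_base h.mul_eq hN hn
      h.prime.ne_zero using 1
    push_cast
    ring_nf
  · have hlt : ℓ < ℓ ^ (j + 1) := lt_self_pow₀ h.prime.one_lt (by lia)
    exact h.isWeightCode_four_zero hF hN (by lia)
      (h.mul_ne_pow_add_one_of_add_two_mul (by lia) hn)
  · obtain rfl : j = 0 := by lia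
    have hn0 : rootTraceCount (ZMod p) F (2 * ℓ ^ (0 + 1)) 0 = 0 := by lia
    rw [hn0] at hrows
    exact hrows.isWeightCode_three_of_eq_zero h.three_le_base h.mul_eq hN

theorem hasWeightTable_of_sq_ne_of_sq_ne (h : IsPrimitiveDatum p ℓ j s r)
    (hF : Fintype.card F = p ^ (2 * (s + 1))) (hN : N = (p ^ (s + 1) - 1) * r) (hu : u ≠ 0)
    (hφ : u ^ 2 ≠ ((ℓ ^ (j + 1)).totient : ZMod p) ^ 2) (hg : u ^ 2 ≠ (ℓ : ZMod p) ^ (2 * j)) :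
    HasWeightTable (code p (definingSet p F N u))
      [(0, 1),
        ((p : ℝ) ^ (2 * (2 * s + 1) + 1), (p : ℝ) - 1),
        ((p : ℝ) ^ (2 * (2 * s + 1)) * (p - 1), ((p : ℝ) ^ (2 * (s + 1))) ^ 2 - p)] ∧
      IsWeightCode 2 (code p (definingSet p F N u)) := by
  have hrows := h.hasWeightRows (u := u) hF hN
  rw [h.rootTraceCount_of_ne_zero hF hu, if_neg hφ, if_neg hg, if_neg hu] at hrows
  have htwo := hrows.hasWeightRows_two h.mul_eq hN
  have hp : (3 : ℝ) ≤ p := by exact_mod_cast h.three_le_base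
  have hp1 : (0 : ℝ) < p - 1 := by linarith
  have hpow (m : ℕ) : (0 : ℝ) < (p : ℝ) ^ m := by positivity
  have hlt : (p : ℝ) < (p ^ (2 * (s + 1))) ^ 2 := by
    rw [← pow_mul]
    exact lt_self_pow₀ (by linarith) (by lia)
  have hpos : ∀ a ∈ [((p : ℝ) ^ (2 * (2 * s + 1) + 1), (p : ℝ) - 1),
      ((p : ℝ) ^ (2 * (2 * s + 1)) * (p - 1), (p ^ (2 * (s + 1))) ^ 2 - p)],
      0 < a.1 ∧ 0 < a.2 := by
    simp only [List.forall_mem_cons, hpow, hp1, mul_pos, sub_pos, hlt, List.not_mem_nil,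
      false_imp_iff, implies_true, and_self]
  have hne : (p : ℝ) ^ (2 * (2 * s + 1) + 1) ≠ p ^ (2 * (2 * s + 1)) * (p - 1) := by
    rw [pow_succ]
    exact ((mul_lt_mul_iff_right₀ (hpow _)).2 (sub_one_lt _)).ne'
  refine ⟨htwo.hasWeightTable fun a ha => (hpos a ha).1, ?_⟩
  have hcode := htwo.isWeightCode hpos
  rwa [List.toFinset_card_of_nodup (by simpa using hne)] at hcode

theorem hasWeightTable_of_sq_eq_of_sq_ne (h : IsPrimitiveDatum p ℓ j s r)
    (hF : Fintype.card F = p ^ (2 * (s + 1))) (hN : N = (p ^ (s + 1) - 1) * r) (hu : u ≠ 0)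
    (hφ : u ^ 2 = ((ℓ ^ (j + 1)).totient : ZMod p) ^ 2) (hg : u ^ 2 ≠ (ℓ : ZMod p) ^ (2 * j)) :
    HasWeightTable (code p (definingSet p F N u))
      [(0, 1),
        ((p : ℝ) ^ (2 * (2 * s + 1) + 1) - p ^ (2 * s + 1) * N, (p : ℝ) - 1),
        ((p : ℝ) ^ (2 * (2 * s + 1)) * (p - 1) - p ^ (2 * s + 1) * p ^ (s + 1)
            + p ^ (2 * s + 1) * r,
          (p - 1) * N),
        ((p : ℝ) ^ (2 * (2 * s + 1)) * (p - 1) + p ^ (2 * s + 1) * r,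
          (p - 1) * (2 * (ℓ : ℝ) ^ (j + 1) - 1) * N),
        ((p : ℝ) ^ (2 * (2 * s + 1)) * (p - 1),
          (p : ℝ) ^ (2 * (s + 1)) - 1 + p ^ (2 * (s + 1)) * (p ^ (2 * (s + 1)) - p))] ∧
      (¬(ℓ = 3 ∧ j + 1 = 1 ∧ (p = 5 ∨ p = 11)) →
        IsWeightCode 4 (code p (definingSet p F N u))) ∧
      (ℓ = 3 ∧ j + 1 = 1 ∧ (p = 5 ∨ p = 11) →
        IsWeightCode 3 (code p (definingSet p F N u))) := by
  have hn := h.rootTraceCount_of_ne_zero hF hu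
  rw [if_pos hφ, if_neg hg, add_zero] at hn
  have hcode := h.isWeightCode_of_ne_zero hF hN hu hn one_pos h.prime.one_le
  rw [one_mul] at hcode
  have hiff := h.eq_pow_or_eq_pow_add_one_iff
  rw [← Nat.add_eq_right (a := j) (b := 1)] at hiff
  refine ⟨?_, fun hne => ?_, fun heq => ?_⟩
  · simpa only [Nat.cast_one, mul_one] using h.hasWeightTable_of_ne_zero hF hN hu hn
  · rwa [if_neg (hiff.not.2 hne)] at hcode
  · rwa [if_pos (hiff.2 heq)] at hcode

theorem hasWeightTable_of_sq_eq_of_sq_eq (h : IsPrimitiveDatum p ℓ j s r)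
    (hF : Fintype.card F = p ^ (2 * (s + 1))) (hN : N = (p ^ (s + 1) - 1) * r) (hu : u ≠ 0)
    (hφ : u ^ 2 = ((ℓ ^ (j + 1)).totient : ZMod p) ^ 2) (hg : u ^ 2 = (ℓ : ZMod p) ^ (2 * j)) :
    HasWeightTable (code p (definingSet p F N u))
      [(0, 1),
        ((p : ℝ) ^ (2 * (2 * s + 1) + 1) - p ^ (2 * s + 1) * (ℓ * N), (p : ℝ) - 1),
        ((p : ℝ) ^ (2 * (2 * s + 1)) * (p - 1) - p ^ (2 * s + 1) * p ^ (s + 1)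
            + p ^ (2 * s + 1) * (ℓ * r),
          (p - 1) * (ℓ * N)),
        ((p : ℝ) ^ (2 * (2 * s + 1)) * (p - 1) + p ^ (2 * s + 1) * (ℓ * r),
          (p - 1) * (2 * (ℓ : ℝ) ^ j - 1) * (ℓ * N)),
        ((p : ℝ) ^ (2 * (2 * s + 1)) * (p - 1),
          (p : ℝ) ^ (2 * (s + 1)) - 1 + p ^ (2 * (s + 1)) * (p ^ (2 * (s + 1)) - p))] ∧
      IsWeightCode 4 (code p (definingSet p F N u)) := by
  have hn : rootTraceCount (ZMod p) F (2 * ℓ ^ (j + 1)) u = ℓ := by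
    rw [h.rootTraceCount_of_ne_zero hF hu, if_pos hφ, if_pos hg]
    exact Nat.add_sub_of_le h.prime.one_le
  constructor
  · convert h.hasWeightTable_of_ne_zero hF hN hu hn using 1
    ring_nf
  · have hcode := h.isWeightCode_of_ne_zero hF hN hu hn h.prime.pos le_rfl
    rwa [if_neg (not_or.2 ⟨h.mul_ne_pow, h.mul_ne_pow_add_one⟩)] at hcode

theorem hasWeightTable_of_sq_ne_of_sq_eq (h : IsPrimitiveDatum p ℓ j s r)
    (hF : Fintype.card F = p ^ (2 * (s + 1))) (hN : N = (p ^ (s + 1) - 1) * r) (hu : u ≠ 0)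
    (hφ : u ^ 2 ≠ ((ℓ ^ (j + 1)).totient : ZMod p) ^ 2) (hg : u ^ 2 = (ℓ : ZMod p) ^ (2 * j)) :
    HasWeightTable (code p (definingSet p F N u))
      [(0, 1),
        ((p : ℝ) ^ (2 * (2 * s + 1) + 1) - p ^ (2 * s + 1) * (ℓ - 1) * N, (p : ℝ) - 1),
        ((p : ℝ) ^ (2 * (2 * s + 1)) * (p - 1) - p ^ (2 * s + 1) * p ^ (s + 1)
            + p ^ (2 * s + 1) * (ℓ - 1) * r,
          (p - 1) * (ℓ - 1) * N),
        ((p : ℝ) ^ (2 * (2 * s + 1)) * (p - 1) + p ^ (2 * s + 1) * (ℓ - 1) * r,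
          (p - 1) * (2 * (ℓ : ℝ) ^ (j + 1) - ℓ + 1) * N),
        ((p : ℝ) ^ (2 * (2 * s + 1)) * (p - 1),
          (p : ℝ) ^ (2 * (s + 1)) - 1 + p ^ (2 * (s + 1)) * (p ^ (2 * (s + 1)) - p))] ∧
      (¬(ℓ = 3 ∧ j + 1 = 1 ∧ p = 5) → IsWeightCode 4 (code p (definingSet p F N u))) ∧
      (ℓ = 3 ∧ j + 1 = 1 ∧ p = 5 → IsWeightCode 3 (code p (definingSet p F N u))) := by
  have hn : rootTraceCount (ZMod p) F (2 * ℓ ^ (j + 1)) u = ℓ - 1 := by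
    rw [h.rootTraceCount_of_ne_zero hF hu, if_neg hφ, if_pos hg, zero_add]
  have h3 := h.three_le
  have hdvd : ¬ p ∣ ℓ - 2 := fun hdvd => hφ <| by
    rw [← ZMod.natCast_eq_zero_iff, Nat.cast_sub (by lia), Nat.cast_ofNat] at hdvd
    rw [hg, h.natCast_totient]
    linear_combination (-(ℓ : ZMod p) ^ (2 * j) * ℓ) * hdvd
  have hcode := h.isWeightCode_of_ne_zero hF hN hu hn (by lia) (by lia)
  simp only [h.ne_pow_of_even (h.odd.tsub_odd odd_one), false_or] at hcode
  have hiff := h.pred_mul_eq_pow_add_one_iff hdvd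
  rw [← Nat.add_eq_right (a := j) (b := 1)] at hiff
  refine ⟨?_, fun hne => ?_, fun heq => ?_⟩
  · convert h.hasWeightTable_of_ne_zero hF hN hu hn using 1
    push_cast [Nat.cast_pred h.prime.pos]
    ring_nf
  · rwa [if_neg (hiff.not.2 hne)] at hcode
  · rwa [if_pos (hiff.2 heq)] at hcode

end IsPrimitiveDatum

end Cases

end TraceCode

theorem theorem1 (p ℓ k e q : ℕ) [Fact p.Prime] (hℓ : ℓ.Prime) (hp2 : p ≠ 2) (hℓ2 : ℓ ≠ 2)
    (hpℓ : p ≠ ℓ) (hk : 1 ≤ k) (he : e = Nat.totient (ℓ ^ k)) (hq : q = p ^ e)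
    (hprim : orderOf (p : ZMod (2 * ℓ ^ k)) = Nat.totient (2 * ℓ ^ k))
    (F : Type*) [Field F] [Fintype F] [DecidableEq F] [Algebra (ZMod p) F]
    (hF : Fintype.card F = q)
    (N : ℕ) (hN : N = (q - 1) / (2 * ℓ ^ k)) (u : ZMod p)
    (D : Finset (F × F)) (hD : D = TraceCode.definingSet p F N u) :
    -- length
    (u = 0 → D.card = p ^ (2 * e - 1) - 1) ∧
    (u ≠ 0 → D.card = p ^ (2 * e - 1)) ∧
    -- dimension
    Module.finrank (ZMod p) (TraceCode.code p D) = 2 * e ∧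
    -- case 1
    (u = 0 → (ℓ : ZMod p) = 1 →
      TraceCode.HasWeightTable (TraceCode.code p D)
        [(0, 1),
         ((p : ℝ) ^ (e - 1) * ((ℓ : ℝ) - 1) * (((q : ℝ) - 1) / (ℓ : ℝ) ^ k),
           (p : ℝ) - 1),
         ((p : ℝ) ^ (2 * e - 2) * ((p : ℝ) - 1)
            + (p : ℝ) ^ (e - 1) * (√(q : ℝ) - ((ℓ : ℝ) - 1) * ((√(q : ℝ) + 1) / (ℓ : ℝ) ^ k)),
           ((p : ℝ) - 1) * ((ℓ : ℝ) - 1) * (((q : ℝ) - 1) / (ℓ : ℝ) ^ k)),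
         ((p : ℝ) ^ (2 * e - 2) * ((p : ℝ) - 1)
            - (p : ℝ) ^ (e - 1) * ((ℓ : ℝ) - 1) * ((√(q : ℝ) + 1) / (ℓ : ℝ) ^ k),
           ((p : ℝ) - 1) * ((ℓ : ℝ) ^ k - (ℓ : ℝ) + 1) * (((q : ℝ) - 1) / (ℓ : ℝ) ^ k)),
         ((p : ℝ) ^ (2 * e - 2) * ((p : ℝ) - 1),
           ((q : ℝ) - 1) + ((q : ℝ) - (p : ℝ)) * (q : ℝ))] ∧
      TraceCode.IsWeightCode 4 (TraceCode.code p D)) ∧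
    -- case 2
    (u = 0 → (ℓ : ZMod p) ≠ 1 →
      TraceCode.HasWeightTable (TraceCode.code p D)
        [(0, 1),
         ((p : ℝ) ^ (e - 1) * (((q : ℝ) - 1) / (ℓ : ℝ) ^ (k - 1)),
           (p : ℝ) - 1),
         ((p : ℝ) ^ (2 * e - 2) * ((p : ℝ) - 1)
            + (p : ℝ) ^ (e - 1) * (√(q : ℝ) - (√(q : ℝ) + 1) / (ℓ : ℝ) ^ (k - 1)),
           ((p : ℝ) - 1) * (((q : ℝ) - 1) / (ℓ : ℝ) ^ (k - 1))),
         ((p : ℝ) ^ (2 * e - 2) * ((p : ℝ) - 1)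
            - (p : ℝ) ^ (e - 1) * ((√(q : ℝ) + 1) / (ℓ : ℝ) ^ (k - 1)),
           ((p : ℝ) - 1) * ((ℓ : ℝ) ^ (k - 1) - 1) * (((q : ℝ) - 1) / (ℓ : ℝ) ^ (k - 1))),
         ((p : ℝ) ^ (2 * e - 2) * ((p : ℝ) - 1),
           ((q : ℝ) - 1) + ((q : ℝ) - (p : ℝ)) * (q : ℝ))] ∧
      (k ≠ 1 → TraceCode.IsWeightCode 4 (TraceCode.code p D)) ∧
      (k = 1 → TraceCode.IsWeightCode 3 (TraceCode.code p D))) ∧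
    -- case 3
    (u ≠ 0 → u ^ 2 ≠ (Nat.totient (ℓ ^ k) : ZMod p) ^ 2 → u ^ 2 ≠ (ℓ : ZMod p) ^ (2 * (k - 1)) →
      TraceCode.HasWeightTable (TraceCode.code p D)
        [(0, 1),
         ((p : ℝ) ^ (2 * e - 1), (p : ℝ) - 1),
         ((p : ℝ) ^ (2 * e - 2) * ((p : ℝ) - 1), (q : ℝ) ^ 2 - (p : ℝ))] ∧
      TraceCode.IsWeightCode 2 (TraceCode.code p D)) ∧
    -- case 4
    (u ≠ 0 → u ^ 2 = (Nat.totient (ℓ ^ k) : ZMod p) ^ 2 → u ^ 2 ≠ (ℓ : ZMod p) ^ (2 * (k - 1)) →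
      TraceCode.HasWeightTable (TraceCode.code p D)
        [(0, 1),
         ((p : ℝ) ^ (2 * e - 1) - (p : ℝ) ^ (e - 1) * (((q : ℝ) - 1) / (2 * (ℓ : ℝ) ^ k)),
           (p : ℝ) - 1),
         ((p : ℝ) ^ (2 * e - 2) * ((p : ℝ) - 1) - (p : ℝ) ^ (e - 1) * √(q : ℝ)
            + (p : ℝ) ^ (e - 1) * ((√(q : ℝ) + 1) / (2 * (ℓ : ℝ) ^ k)),
           ((p : ℝ) - 1) * (((q : ℝ) - 1) / (2 * (ℓ : ℝ) ^ k))),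
         ((p : ℝ) ^ (2 * e - 2) * ((p : ℝ) - 1)
            + (p : ℝ) ^ (e - 1) * ((√(q : ℝ) + 1) / (2 * (ℓ : ℝ) ^ k)),
           ((p : ℝ) - 1) * (2 * (ℓ : ℝ) ^ k - 1) * (((q : ℝ) - 1) / (2 * (ℓ : ℝ) ^ k))),
         ((p : ℝ) ^ (2 * e - 2) * ((p : ℝ) - 1),
           ((q : ℝ) - 1) + (q : ℝ) * ((q : ℝ) - (p : ℝ)))] ∧
      (¬ (ℓ = 3 ∧ k = 1 ∧ (p = 5 ∨ p = 11)) →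
        TraceCode.IsWeightCode 4 (TraceCode.code p D)) ∧
      (ℓ = 3 ∧ k = 1 ∧ (p = 5 ∨ p = 11) →
        TraceCode.IsWeightCode 3 (TraceCode.code p D))) ∧
    -- case 5
    (u ≠ 0 →
      (u = (Nat.totient (ℓ ^ k) : ZMod p) ∧
          (Nat.totient (ℓ ^ k) : ZMod p) = (ℓ : ZMod p) ^ (k - 1)) ∨
        (u = -(Nat.totient (ℓ ^ k) : ZMod p) ∧
          -(Nat.totient (ℓ ^ k) : ZMod p) = -(ℓ : ZMod p) ^ (k - 1)) →
      TraceCode.HasWeightTable (TraceCode.code p D)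
        [(0, 1),
         ((p : ℝ) ^ (2 * e - 1) - (p : ℝ) ^ (e - 1) * (((q : ℝ) - 1) / (2 * (ℓ : ℝ) ^ (k - 1))),
           (p : ℝ) - 1),
         ((p : ℝ) ^ (2 * e - 2) * ((p : ℝ) - 1) - (p : ℝ) ^ (e - 1) * √(q : ℝ)
            + (p : ℝ) ^ (e - 1) * ((√(q : ℝ) + 1) / (2 * (ℓ : ℝ) ^ (k - 1))),
           ((p : ℝ) - 1) * (((q : ℝ) - 1) / (2 * (ℓ : ℝ) ^ (k - 1)))),
         ((p : ℝ) ^ (2 * e - 2) * ((p : ℝ) - 1)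
            + (p : ℝ) ^ (e - 1) * ((√(q : ℝ) + 1) / (2 * (ℓ : ℝ) ^ (k - 1))),
           ((p : ℝ) - 1) * (2 * (ℓ : ℝ) ^ (k - 1) - 1)
             * (((q : ℝ) - 1) / (2 * (ℓ : ℝ) ^ (k - 1)))),
         ((p : ℝ) ^ (2 * e - 2) * ((p : ℝ) - 1),
           ((q : ℝ) - 1) + (q : ℝ) * ((q : ℝ) - (p : ℝ)))] ∧
      TraceCode.IsWeightCode 4 (TraceCode.code p D)) ∧
    -- case 6
    (u ≠ 0 → u ^ 2 ≠ (Nat.totient (ℓ ^ k) : ZMod p) ^ 2 → u ^ 2 = (ℓ : ZMod p) ^ (2 * (k - 1)) →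
      TraceCode.HasWeightTable (TraceCode.code p D)
        [(0, 1),
         ((p : ℝ) ^ (2 * e - 1)
            - (p : ℝ) ^ (e - 1) * ((ℓ : ℝ) - 1) * (((q : ℝ) - 1) / (2 * (ℓ : ℝ) ^ k)),
           (p : ℝ) - 1),
         ((p : ℝ) ^ (2 * e - 2) * ((p : ℝ) - 1) - (p : ℝ) ^ (e - 1) * √(q : ℝ)
            + (p : ℝ) ^ (e - 1) * ((ℓ : ℝ) - 1) * ((√(q : ℝ) + 1) / (2 * (ℓ : ℝ) ^ k)),
           ((p : ℝ) - 1) * ((ℓ : ℝ) - 1) * (((q : ℝ) - 1) / (2 * (ℓ : ℝ) ^ k))),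
         ((p : ℝ) ^ (2 * e - 2) * ((p : ℝ) - 1)
            + (p : ℝ) ^ (e - 1) * ((ℓ : ℝ) - 1) * ((√(q : ℝ) + 1) / (2 * (ℓ : ℝ) ^ k)),
           ((p : ℝ) - 1) * (2 * (ℓ : ℝ) ^ k - (ℓ : ℝ) + 1)
             * (((q : ℝ) - 1) / (2 * (ℓ : ℝ) ^ k))),
         ((p : ℝ) ^ (2 * e - 2) * ((p : ℝ) - 1),
           ((q : ℝ) - 1) + (q : ℝ) * ((q : ℝ) - (p : ℝ)))] ∧
      (¬ (ℓ = 3 ∧ k = 1 ∧ p = 5) → TraceCode.IsWeightCode 4 (TraceCode.code p D)) ∧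
      (ℓ = 3 ∧ k = 1 ∧ p = 5 → TraceCode.IsWeightCode 3 (TraceCode.code p D))) := by
  obtain ⟨j, rfl⟩ := Nat.exists_eq_add_of_le' hk
  obtain ⟨s, r, h⟩ := TraceCode.exists_isPrimitiveDatum Fact.out hp2 hℓ hℓ2 hprim
  obtain rfl := he.trans h.totient_eq
  subst hq hD
  have hN' := h.exponent_eq_of_eq_div hN
  have hcard := h.card_definingSet_add (u := u) hF hN'
  have hsqrt : √((p : ℝ) ^ (2 * (s + 1))) = p ^ (s + 1) := by
    rw [mul_comm, pow_mul, Real.sqrt_sq (by positivity)]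
  obtain ⟨hq₁, hq₂, hq₃, hq₄⟩ := h.div_eq (h.natCast_mul_exponent_eq hN')
  obtain ⟨hr₁, hr₂, hr₃, hr₄⟩ := h.div_eq h.natCast_mul_eq
  simp only [show 2 * (s + 1) - 1 = 2 * s + 1 by lia,
    show 2 * (2 * (s + 1)) - 1 = 2 * (2 * s + 1) + 1 by lia,
    show 2 * (2 * (s + 1)) - 2 = 2 * (2 * s + 1) by lia,
    Nat.add_sub_cancel, Nat.cast_pow, hsqrt, hq₁, hq₂, hq₃, hq₄, hr₁, hr₂, hr₃, hr₄]
  refine ⟨fun hu => by simp [← hcard, hu], fun hu => by simp [← hcard, hu],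
    TraceCode.finrank_code_of_injective hF (h.injective_codeword hF hN'),
    fun hu hℓp => hu ▸ h.hasWeightTable_zero_of_eq_one hF hN' hℓp,
    fun hu hℓp => hu ▸ h.hasWeightTable_zero_of_ne_one hF hN' hℓp,
    h.hasWeightTable_of_sq_ne_of_sq_ne hF hN', h.hasWeightTable_of_sq_eq_of_sq_ne hF hN',
    fun hu hφ => ?_, h.hasWeightTable_of_sq_ne_of_sq_eq hF hN'⟩
  refine h.hasWeightTable_of_sq_eq_of_sq_eq hF hN' hu
    (sq_eq_sq_iff_eq_or_eq_neg.2 (hφ.imp And.left And.left)) ?_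
  rw [mul_comm, pow_mul]
  exact sq_eq_sq_iff_eq_or_eq_neg.2 (hφ.imp (And.elim Eq.trans) (And.elim Eq.trans))
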